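/- Proposition (Equivariant sheaf on the coinvariant algebra descends to the coarse quotient iff its fiber is trivial). Let $k$ be a field of characteristic $0$, let $H$ be a finite group acting linearly on a $k$-vector space $V$, and let $H$ act on $\mathrm{Sym}(V^\vee)$ through the dual action on $V^\vee$. Let $$C=\mathrm{Sym}(V^\vee)/I,\qquad I=\text{the ideal generated by the homogeneous } H\text{-invariants of positive degree},$$ be the coinvariant algebra, with its induced $H$-action and its augmentation $\varepsilon\colon C\to k$ (evaluation at the origin). Write $\mathrm{QCoh}(\mathrm{Spec}\,C)^H$ for the unbounded derived category of $H$-equivariant $C$-modules, i.e. of $C$-modules with a semilinear $H$-action (equivalently, of modules over the skew group algebra $C\rtimes H$). Then: 1. $C^H=k$, so the coarse quotient $\mathrm{Spec}(C)/\!/H=\mathrm{Spec}(C^H)$ is $\mathrm{Spec}\,k$. 2. $\ker\varepsilon$ is the unique maximal ideal of $C$; that is, $\varepsilon$ corresponds to the unique closed point $i\colon \mathrm{Spec}\,k\to\mathrm{Spec}\,C$. 3. Let $F$ be an object of $\mathrm{QCoh}(\mathrm{Spec}\,C)^H$. Then $F$ descends to $\mathrm{Spec}(C)/\!/H=\mathrm{Spec}\,k$,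 i.e. it is isomorphic to $C\otimes_k W$ with $H$-action $h(c\otimes w)=h(c)\otimes w$ for some object $W$ of the unbounded derived category $D(\mathrm{Vect}_k)$, if and only if $H$ acts trivially on the derived fiber $i^*(F)=k\otimes^{\mathbf L}_C F$, i.e. $i^*(F)$, with its natural $H$-action as an object of the unbounded derived category $D(\mathrm{Rep}_k(H))$, lies in the essential image of the functor $D(\mathrm{Vect}_k)\to D(\mathrm{Rep}_k(H))$ that equips a complex with the trivial action. -/

import Mathlib

universe u

namespace CoinvariantDescent

noncomputable section

/-! ### The coinvariant algebra, equivariant sheaves, pullback and fibre -/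

section Underived

open CategoryTheory CategoryTheory.Limits
open scoped TensorProduct

section Coinvariants

variable {k V H : Type u} [Field k] [AddCommGroup V] [Module k V] [Group H]

/-- The algebra `Sym(V^∨)` of polynomial functions on the representation `V` of `H`. -/
def Poly (_ρ : Representation k H V) : Type u := SymmetricAlgebra k (Module.Dual k V)

variable (ρ : Representation k H V)

instance : CommRing (Poly ρ) :=
  inferInstanceAs (CommRing (SymmetricAlgebra k (Module.Dual k V)))

instance : Algebra k (Poly ρ) :=
  inferInstanceAs (Algebra k (SymmetricAlgebra k (Module.Dual k V)))

namespace Poly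

/-- The inclusion of the linear functions `V^∨` in `Sym(V^∨)`. -/
def ι : Module.Dual k V →ₗ[k] Poly ρ := SymmetricAlgebra.ι k (Module.Dual k V)

/-- The algebra endomorphism of `Sym(V^∨)` induced by the dual action of `h` on `V^∨`. -/
def act (h : H) : Poly ρ →ₐ[k] Poly ρ := SymmetricAlgebra.lift (ι ρ ∘ₗ ρ.dual h)

variable {ρ} in
lemma algHom_ext {A : Type*} [CommSemiring A] [Algebra k A] {f g : Poly ρ →ₐ[k] A}
    (h : ∀ x, f (ι ρ x) = g (ι ρ x)) : f = g :=
  SymmetricAlgebra.algHom_ext (LinearMap.ext h)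

lemma act_ι (h : H) (x : Module.Dual k V) : act ρ h (ι ρ x) = ι ρ (ρ.dual h x) :=
  SymmetricAlgebra.lift_ι_apply _ x

instance : MulSemiringAction H (Poly ρ) where
  smul h f := act ρ h f
  one_smul f := congr($(algHom_ext (f := act ρ 1) (g := AlgHom.id k _)
    (fun x => by simp only [act_ι, map_one, Module.End.one_apply, AlgHom.id_apply])) f)
  mul_smul g h f := congr($(algHom_ext (f := act ρ (g * h)) (g := (act ρ g).comp (act ρ h))
    (fun x => by simp only [AlgHom.comp_apply, act_ι, map_mul, Module.End.mul_apply])) f)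
  smul_zero h := map_zero (act ρ h)
  smul_add h := map_add (act ρ h)
  smul_one h := map_one (act ρ h)
  smul_mul h := map_mul (act ρ h)

lemma smul_def (h : H) (f : Poly ρ) : h • f = act ρ h f := rfl

instance : SMulCommClass H k (Poly ρ) where
  smul_comm h a f := map_smul (act ρ h) a f

/-- Evaluation of polynomial functions at the origin of `V`, i.e. the projection of `Sym(V^∨)`
on its homogeneous component of degree `0`. -/
def eval₀ : Poly ρ →ₐ[k] k := SymmetricAlgebra.algebraMapInv

lemma eval₀_ι (x : Module.Dual k V) : eval₀ ρ (ι ρ x) = 0 :=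
  SymmetricAlgebra.algebraMapInv_ι x

lemma eval₀_smul (h : H) (f : Poly ρ) : eval₀ ρ (h • f) = eval₀ ρ f :=
  congr($(algHom_ext (f := (eval₀ ρ).comp (act ρ h)) (g := eval₀ ρ)
    (fun x => by simp only [AlgHom.comp_apply, act_ι, eval₀_ι])) f)

end Poly

/-- The ideal of `Sym(V^∨)` generated by the `H`-invariants without constant term, equivalently by
the homogeneous `H`-invariants of positive degree. -/
def invariantIdeal : Ideal (Poly ρ) :=
  Ideal.span {f | (∀ h : H, h • f = f) ∧ Poly.eval₀ ρ f = 0}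

/-- The coinvariant algebra `Sym(V^∨) / (Sym(V^∨)^H_+) = Sym(V^∨) ⊗_{Sym(V^∨)^H} k`. -/
def CoinvariantAlgebra : Type u := Poly ρ ⧸ invariantIdeal ρ

instance : CommRing (CoinvariantAlgebra ρ) := inferInstanceAs (CommRing (Poly ρ ⧸ invariantIdeal ρ))

instance : Algebra k (CoinvariantAlgebra ρ) :=
  inferInstanceAs (Algebra k (Poly ρ ⧸ invariantIdeal ρ))

namespace CoinvariantAlgebra

/-- The quotient map `Sym(V^∨) → C`. -/
def mk : Poly ρ →ₐ[k] CoinvariantAlgebra ρ := Ideal.Quotient.mkₐ k (invariantIdeal ρ)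

lemma mk_surjective : Function.Surjective (mk ρ) := Ideal.Quotient.mk_surjective

variable {ρ} in
lemma algHom_ext {A : Type*} [Semiring A] [Algebra k A] {f g : CoinvariantAlgebra ρ →ₐ[k] A}
    (h : ∀ x, f (mk ρ x) = g (mk ρ x)) : f = g :=
  AlgHom.ext fun x => by obtain ⟨x, rfl⟩ := mk_surjective ρ x; exact h x

/-- The action of `h` on `C` induced by its action on `Sym(V^∨)`. -/
def act (h : H) : CoinvariantAlgebra ρ →ₐ[k] CoinvariantAlgebra ρ :=
  Ideal.Quotient.liftₐ (invariantIdeal ρ) ((mk ρ).comp (Poly.act ρ h)) (by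
    intro f hf
    refine (RingHom.mem_ker (f := (mk ρ).comp (Poly.act ρ h))).1 (?_ : f ∈ RingHom.ker _)
    refine (Ideal.span_le.2 fun f hf => ?_ : invariantIdeal ρ ≤ _) hf
    have : Poly.act ρ h f = f := hf.1 h
    simp only [SetLike.mem_coe, RingHom.mem_ker, AlgHom.comp_apply, this]
    exact Ideal.Quotient.eq_zero_iff_mem.2 (Ideal.subset_span hf))

lemma act_mk (h : H) (f : Poly ρ) : act ρ h (mk ρ f) = mk ρ (h • f) := rfl

instance : MulSemiringAction H (CoinvariantAlgebra ρ) where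
  smul h f := act ρ h f
  one_smul f := congr($(algHom_ext (f := act ρ 1) (g := AlgHom.id k _)
    (fun x => by simp [act_mk])) f)
  mul_smul g h f := congr($(algHom_ext (f := act ρ (g * h)) (g := (act ρ g).comp (act ρ h))
    (fun x => by simp only [AlgHom.comp_apply, act_mk, mul_smul])) f)
  smul_zero h := map_zero (act ρ h)
  smul_add h := map_add (act ρ h)
  smul_one h := map_one (act ρ h)
  smul_mul h := map_mul (act ρ h)

lemma smul_mk (h : H) (f : Poly ρ) : h • mk ρ f = mk ρ (h • f) := rfl

instance : SMulCommClass H k (CoinvariantAlgebra ρ) where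
  smul_comm h a f := map_smul (act ρ h) a f

/-- The augmentation `C → k` by evaluation at the origin. -/
def ε : CoinvariantAlgebra ρ →ₐ[k] k :=
  Ideal.Quotient.liftₐ (invariantIdeal ρ) (Poly.eval₀ ρ) (by
    intro f hf
    exact RingHom.mem_ker.1 ((Ideal.span_le.2 fun f hf => hf.2 :
      invariantIdeal ρ ≤ RingHom.ker (Poly.eval₀ ρ)) hf))

lemma ε_mk (f : Poly ρ) : ε ρ (mk ρ f) = Poly.eval₀ ρ f := rfl

lemma ε_smul (h : H) (c : CoinvariantAlgebra ρ) : ε ρ (h • c) = ε ρ c := by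
  obtain ⟨c, rfl⟩ := mk_surjective ρ c
  rw [smul_mk, ε_mk, ε_mk, Poly.eval₀_smul]

end CoinvariantAlgebra
end Coinvariants

section Equivariant

variable {k C H : Type u} [Field k] [CommRing C] [Algebra k C] [Group H] [MulSemiringAction H C]

variable (C H) in
/-- The category of `H`-equivariant quasi-coherent sheaves on `Spec C`, that is, of `C`-modules
with a semilinear action of `H`: these are the modules over the skew group algebra `C ⋊ H`, the
free `C`-module on `H` with multiplication `(c • g) * (c' • h) = (c * g(c')) • (g * h)`. -/
abbrev EquivariantModule : Type (u + 1) := ModuleCat.{u} (SkewMonoidAlgebra C H)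

instance (M : EquivariantModule C H) : Module C M :=
  Module.compHom M (SkewMonoidAlgebra.singleOneRingHom (k := C) (G := H))

lemma smul_eq (M : EquivariantModule C H) (c : C) (m : M) :
    c • m = (SkewMonoidAlgebra.single (1 : H) c) • m := rfl

variable (C) in
/-- `C` as an equivariant module: `(c • h) • x = c * h(x)`. -/
def regular : SkewMonoidAlgebra C H →+* Module.End ℤ C :=
  SkewMonoidAlgebra.liftNCRingHom
    (Module.toModuleEnd ℤ (S := C) C : C →+* Module.End ℤ C)
    { toFun h := (DistribMulAction.toAddMonoidEnd H C h).toIntLinearMap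
      map_one' := by ext; simp
      map_mul' _ _ := by ext; simp [mul_smul] }
    (by intro c h; ext x; simp)

instance : Module (SkewMonoidAlgebra C H) C := Module.compHom C (regular C)

lemma single_smul (h : H) (c x : C) : SkewMonoidAlgebra.single h c • x = c * h • x := by
  change regular C (SkewMonoidAlgebra.single h c) x = _
  simp [regular, SkewMonoidAlgebra.liftNCRingHom]

section

variable [SMulCommClass H k C]

instance : SMulCommClass k (SkewMonoidAlgebra C H) C where
  smul_comm a r x := by
    induction r using SkewMonoidAlgebra.induction_on with
    | zero => simp
    | single h c => simp [single_smul, smul_comm]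
    | add r s hr hs => simp [add_smul, hr, hs]

variable (k C H) in
/-- The pullback of sheaves along `Spec(C)/H → Spec k`, sending the vector space `W` to the
equivariant `C`-module `C ⊗ W` with `h(c ⊗ w) = h(c) ⊗ w`. -/
def pullback : ModuleCat.{u} k ⥤ EquivariantModule C H where
  obj W := ModuleCat.of _ (C ⊗[k] W)
  map f := ModuleCat.ofHom
    { f.hom.lTensor C with
      map_smul' r x := by
        change f.hom.lTensor C (r • x) = r • f.hom.lTensor C x
        induction x with
        | zero => simp
        | tmul c w => rfl
        | add x y hx hy => simp only [smul_add, map_add, hx, hy] }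
  map_id W := by
    ext x
    exact congr($(LinearMap.lTensor_id C W) x)
  map_comp f g := by
    ext x
    exact congr($(LinearMap.lTensor_comp C g.hom f.hom) x)

lemma pullback_map_apply {W W' : ModuleCat.{u} k} (f : W ⟶ W') (x : C ⊗[k] W) :
    (pullback k C H).map f x = f.hom.lTensor C x := rfl

instance : (pullback k C H).Additive where
  map_add {_ _ f g} := by
    ext x
    exact congr($(LinearMap.lTensor_add C f.hom g.hom) x)

lemma pullback_shortExact (S : ShortComplex (ModuleCat.{u} k)) (hS : S.ShortExact) :
    (S.map (pullback k C H)).ShortExact where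
  exact := (ShortComplex.moduleCat_exact_iff _).2 fun x hx =>
    (lTensor_exact C ((ShortComplex.ShortExact.moduleCat_exact_iff_function_exact S).1 hS.exact)
      hS.moduleCat_surjective_g x).1 hx
  mono_f := (ModuleCat.mono_iff_injective _).2
    (Module.Flat.lTensor_preserves_injective_linearMap S.f.hom hS.moduleCat_injective_f)
  epi_g := (ModuleCat.epi_iff_surjective _).2
    (LinearMap.lTensor_surjective C hS.moduleCat_surjective_g)

instance : PreservesFiniteLimits (pullback k C H) :=
  (((pullback k C H).exact_tfae.out 0 3 rfl rfl).1 pullback_shortExact).1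

instance : PreservesFiniteColimits (pullback k C H) :=
  (((pullback k C H).exact_tfae.out 0 3 rfl rfl).1 pullback_shortExact).2

end

/-- The field `k`, regarded as a `C`-algebra through `ε : C → k`. -/
def Residue (_ε : C →ₐ[k] k) : Type u := k

variable (ε : C →ₐ[k] k)

instance : AddCommGroup (Residue ε) := inferInstanceAs (AddCommGroup k)
instance : Module k (Residue ε) := inferInstanceAs (Module k k)
instance : Module C (Residue ε) := Module.compHom k ε.toRingHom

lemma residue_smul (c : C) (x : Residue ε) : c • x = ε c • x := rfl

instance : SMulCommClass C k (Residue ε) where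
  smul_comm c a x := smul_comm (ε c) a x

variable (hε : ∀ (h : H) (c : C), ε (h • c) = ε c)

/-- The action of `h` on the fibre `k ⊗_C M` by `h(a ⊗ m) = a ⊗ h(m)`. -/
def fiberAct (M : EquivariantModule C H) (h : H) :
    Residue ε ⊗[C] M →ₗ[k] Residue ε ⊗[C] M :=
  let f : Residue ε ⊗[C] M →ₛₗ[MulSemiringAction.toRingHom H C h] Residue ε ⊗[C] M :=
    TensorProduct.map
      { toFun := fun a => a
        map_add' := fun _ _ => rfl
        map_smul' := fun c a => by
          simp [residue_smul, hε] }
      { toFun := fun m => SkewMonoidAlgebra.single h (1 : C) • m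
        map_add' := smul_add _
        map_smul' := fun c m => by
          simp [smul_eq, smul_smul] }
  { f with
    map_smul' a x := by
      change f (a • x) = a • f x
      induction x with
      | zero => simp
      | tmul c w => rfl
      | add x y hx hy => simp only [smul_add, map_add, hx, hy] }

lemma fiberAct_tmul (M : EquivariantModule C H) (h : H) (a : Residue ε) (m : M) :
    fiberAct ε hε M h (a ⊗ₜ m) = a ⊗ₜ (SkewMonoidAlgebra.single h (1 : C) • m) := rfl

/-- The representation of `H` on the fibre `k ⊗_C M`. -/
def fiberRep (M : EquivariantModule C H) : Representation k H (Residue ε ⊗[C] M) where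
  toFun := fiberAct ε hε M
  map_one' := by
    refine LinearMap.ext fun x => ?_
    induction x with
    | zero => simp
    | tmul c w => rw [fiberAct_tmul, SkewMonoidAlgebra.single_one_one, one_smul]; rfl
    | add x y hx hy => simp only [map_add, hx, hy]
  map_mul' g h := by
    refine LinearMap.ext fun x => ?_
    induction x with
    | zero => simp
    | tmul c w =>
      simp only [Module.End.mul_apply, fiberAct_tmul, smul_smul,
        SkewMonoidAlgebra.single_mul_single, one_mul, smul_one]
    | add x y hx hy => simp only [map_add, hx, hy]


lemma fiberRep_tmul (M : EquivariantModule C H) (h : H) (a : Residue ε) (m : M) :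
    fiberRep ε hε M h (a ⊗ₜ m) = a ⊗ₜ (SkewMonoidAlgebra.single h (1 : C) • m) := rfl

/-- The map induced on fibres by a morphism of equivariant modules. -/
def fiberMap {M N : EquivariantModule C H} (f : M ⟶ N) :
    Residue ε ⊗[C] M →ₗ[k] Residue ε ⊗[C] N :=
  let g : Residue ε ⊗[C] M →ₗ[C] Residue ε ⊗[C] N :=
    LinearMap.lTensor (Residue ε)
      { toFun := f.hom
        map_add' := map_add f.hom
        map_smul' := fun c m => map_smul f.hom (SkewMonoidAlgebra.single (1 : H) c) m }
  { g with
    map_smul' a x := by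
      change g (a • x) = a • g x
      induction x with
      | zero => simp
      | tmul c w => rfl
      | add x y hx hy => simp only [smul_add, map_add, hx, hy] }

lemma fiberMap_tmul {M N : EquivariantModule C H} (f : M ⟶ N) (a : Residue ε) (m : M) :
    fiberMap ε f (a ⊗ₜ m) = a ⊗ₜ (f.hom m) := rfl

lemma fiberMap_id (M : EquivariantModule C H) (x : Residue ε ⊗[C] M) :
    fiberMap ε (𝟙 M) x = x := by
  induction x with
  | zero => simp
  | tmul c w => rfl
  | add x y hx hy => simp only [map_add, hx, hy]

lemma fiberMap_comp {M N P : EquivariantModule C H} (f : M ⟶ N) (g : N ⟶ P)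
    (x : Residue ε ⊗[C] M) : fiberMap ε (f ≫ g) x = fiberMap ε g (fiberMap ε f x) := by
  induction x with
  | zero => simp
  | tmul c w => rfl
  | add x y hx hy => simp only [map_add, hx, hy]

lemma fiberMap_add {M N : EquivariantModule C H} (f g : M ⟶ N) (x : Residue ε ⊗[C] M) :
    fiberMap ε (f + g) x = fiberMap ε f x + fiberMap ε g x := by
  induction x with
  | zero => simp
  | tmul c w => exact TensorProduct.tmul_add _ _ _
  | add x y hx hy => simp only [map_add, hx, hy]; abel

lemma fiberMap_fiberRep {M N : EquivariantModule C H} (f : M ⟶ N) (h : H)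
    (x : Residue ε ⊗[C] M) :
    fiberMap ε f (fiberRep ε hε M h x) = fiberRep ε hε N h (fiberMap ε f x) := by
  induction x with
  | zero => simp
  | tmul c w => simp only [fiberRep_tmul, fiberMap_tmul, map_smul]
  | add x y hx hy => simp only [map_add, hx, hy]

/-- The underived fibre functor at the `H`-fixed point `ε` of `Spec C`, sending an equivariant
`C`-module `M` to the representation `k ⊗_C M` of `H`. -/
def fiber : EquivariantModule C H ⥤ Rep.{u} k H where
  obj M := Rep.of (fiberRep ε hε M)
  map {M N} f := Rep.ofHom
    { fiberMap ε f with
      isIntertwining' h := LinearMap.ext (fiberMap_fiberRep ε hε f h) }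
  map_id M := by
    ext x
    exact fiberMap_id ε M x
  map_comp f g := by
    ext x
    exact fiberMap_comp ε f g x

instance : (fiber ε hε).Additive where
  map_add {_ _ f g} := by
    ext x
    exact fiberMap_add ε f g x

end Equivariant

section Trivial
variable (k H : Type u) [Field k] [Group H]

instance : (Rep.trivialFunctor.{u} k H).Additive where
  map_add := rfl

instance : PreservesFiniteColimits (Rep.trivialFunctor.{u} k H) :=
  have := (Rep.invariantsAdjunction k H).leftAdjoint_preservesColimits
  inferInstance

instance : PreservesFiniteLimits (Rep.trivialFunctor.{u} k H) :=
  have := (Rep.coinvariantsAdjunction k H).rightAdjoint_preservesLimits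
  inferInstance

instance : HasDerivedCategory (Rep.{u} k H) := HasDerivedCategory.standard _
end Trivial

end Underived

/-! ### Every complex of modules has a K-projective resolution

This is only used to show that total left derived functors exist on unbounded derived categories
of modules. -/

section KProj

open CategoryTheory CategoryTheory.Limits HomologicalComplex
open scoped ZeroObject

variable (R : Type u) [Ring R]

/-- The inclusion of the complex `R` in degree `n + 1` into the contractible complex
`R = R` in degrees `n` and `n + 1`. -/
def cell (n : ℤ) :
    (single (ModuleCat.{u} R) (ComplexShape.up ℤ) (n + 1)).obj (ModuleCat.of R R) ⟶
      double (𝟙 (ModuleCat.of R R)) (show (ComplexShape.up ℤ).Rel n (n + 1) by simp) :=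
  mkHomFromSingle (doubleXIso₁ _ _ (by simp)).inv
    (fun k hk => by rw [double_d_eq_zero₁ _ _ _ _ (by simp at hk; lia)]; simp)

instance (n : ℤ) : Mono (cell R n) := by
  have : ∀ i, Mono ((cell R n).f i) := by
    intro i
    by_cases h : i = n + 1
    · subst h
      simp only [cell, mkHomFromSingle_f]
      infer_instance
    · exact ⟨fun _ _ _ => (isZero_single_obj_X _ _ _ _ h).eq_of_tgt _ _⟩
  exact HomologicalComplex.mono_of_mono_f _ this

/-- The set of generating cofibrations of complexes of `R`-modules. -/
def cells : MorphismProperty (CochainComplex (ModuleCat.{u} R) ℤ) :=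
  MorphismProperty.ofHoms (cell R)

instance : MorphismProperty.IsSmall.{u} (cells R) :=
  MorphismProperty.isSmall_ofHoms.{u} (cell R)

open MorphismProperty in
instance : HasSmallObjectArgument.{u} (cells R) := by
  obtain ⟨κ, hκ', hκ⟩ := HasCardinalLT.exists_regular_cardinal_forall.{u}
    (fun n : ℤ => Subobject
      ((single (ModuleCat.{u} R) (ComplexShape.up ℤ) (n + 1)).obj (ModuleCat.of R R)))
  have : Fact κ.IsRegular := ⟨hκ'⟩
  have : Nonempty κ.ord.ToType := by simpa using hκ'.ne_zero
  have := WellFoundedLT.toOrderBot κ.ord.ToType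
  have hle : cells R ≤ monomorphisms _ := by
    rintro _ _ _ ⟨n⟩
    exact inferInstanceAs (Mono (cell R n))
  have : IsStableUnderCoproducts.{u}
    (monomorphisms (CochainComplex (ModuleCat.{u} R) ℤ)) := inferInstance
  exact ⟨κ, inferInstance, inferInstance,
    { preservesColimit {A B X Y} i hi f hf := by
        let hf' : (monomorphisms _).TransfiniteCompositionOfShape κ.ord.ToType f :=
          { toTransfiniteCompositionOfShape := hf.toTransfiniteCompositionOfShape
            map_mem j hj := by
              have := (hf.attachCells j hj).pushouts_coproducts
              simp only [ofHoms_homFamily] at this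
              refine (?_ : _ ≤ monomorphisms _) _ this
              simp only [pushouts_le_iff, coproducts_le_iff]
              exact hle }
        have (j j' : κ.ord.ToType) (φ : j ⟶ j') : Mono (hf'.F.map φ) := hf'.mem_map φ
        obtain ⟨n⟩ := hi
        exact IsGrothendieckAbelian.preservesColimit_coyoneda_obj_of_mono (Y := hf'.F) (κ := κ)
          (hκ n) }⟩

variable {R}
variable {X Y : CochainComplex (ModuleCat.{u} R) ℤ} (p : X ⟶ Y)

/-- The map of modules `R → M` sending `1` to `m`. -/
abbrev elt {M : ModuleCat.{u} R} (m : M) : ModuleCat.of R R ⟶ M :=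
  ModuleCat.ofHom (LinearMap.toSpanSingleton R M m)

lemma exists_of_rlp (hp : (cells R).rlp p) (n : ℤ) (y : Y.X n) (z : X.X (n + 1))
    (hz : X.d (n + 1) (n + 2) z = 0) (hyz : p.f (n + 1) z = Y.d n (n + 1) y) :
    ∃ x : X.X n, X.d n (n + 1) x = z ∧ p.f n x = y := by
  have hR : (ComplexShape.up ℤ).Rel n (n + 1) := by simp
  let a : (single (ModuleCat.{u} R) (ComplexShape.up ℤ) (n + 1)).obj (ModuleCat.of R R) ⟶ X :=
    mkHomFromSingle (elt z) (by
      rintro k hk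
      obtain rfl : n + 2 = k := by simp at hk; lia
      ext
      simpa using hz)
  let b : double (𝟙 (ModuleCat.of R R)) hR ⟶ Y :=
    mkHomFromDouble hR (by simp) (elt y) (elt y ≫ Y.d n (n + 1)) (by simp) (by simp)
  have := hp _ ⟨n⟩
  have sq : CommSq a (cell R n) p b := ⟨by
    apply from_single_hom_ext
    simp only [a, b, cell, comp_f, mkHomFromSingle_f, mkHomFromDouble_f₁, Category.assoc]
    simp only [Iso.inv_hom_id_assoc]
    congr 1
    ext
    simpa using hyz⟩
  refine ⟨((doubleXIso₀ (𝟙 (ModuleCat.of R R)) hR).inv ≫ sq.lift.f n) (1 : R), ?_, ?_⟩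
  · have h1 := congr_arg (fun φ => (singleObjXSelf (ComplexShape.up ℤ) (n + 1)
      (ModuleCat.of R R)).inv ≫ φ.f (n + 1)) sq.fac_left
    simp only [a, cell, comp_f, mkHomFromSingle_f, Category.assoc, Iso.inv_hom_id_assoc] at h1
    have h2 : (doubleXIso₀ _ hR).inv ≫ sq.lift.f n ≫ X.d n (n + 1) = elt z := by
      rw [sq.lift.comm, double_d _ hR (by simp)]
      simp only [Category.assoc, Category.id_comp, Iso.inv_hom_id_assoc]
      exact h1
    rw [← ModuleCat.comp_apply, Category.assoc, h2]
    simp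
  · have h1 := congr_arg (fun φ => (doubleXIso₀ _ hR).inv ≫ φ.f n) sq.fac_right
    simp only [b, comp_f, mkHomFromDouble_f₀, Iso.inv_hom_id_assoc] at h1
    simpa using congr($h1 1)

lemma rlp_of_exists (h : ∀ (n : ℤ) (y : Y.X n) (z : X.X (n + 1)),
    X.d (n + 1) (n + 2) z = 0 → p.f (n + 1) z = Y.d n (n + 1) y →
    ∃ x : X.X n, X.d n (n + 1) x = z ∧ p.f n x = y) : (cells R).rlp p := by
  suffices key : ∀ n, HasLiftingProperty (cell R n) p by
    rintro _ _ _ ⟨n⟩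
    exact key n
  intro n
  have hR : (ComplexShape.up ℤ).Rel n (n + 1) := by simp
  refine ⟨fun {a b} sq => ?_⟩
  obtain ⟨x, hx, hy⟩ := h n (((doubleXIso₀ _ hR).inv ≫ b.f n) (1 : R))
    (((singleObjXSelf (ComplexShape.up ℤ) (n + 1) (ModuleCat.of R R)).inv ≫ a.f (n + 1)) (1 : R))
    (by
      have := a.comm (n + 1) (n + 2)
      simp only [single_obj_d, zero_comp] at this
      rw [← ModuleCat.comp_apply, Category.assoc, this]
      simp)
    (by
      have h1 := congr_arg (fun φ => (singleObjXSelf (ComplexShape.up ℤ) (n + 1)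
        (ModuleCat.of R R)).inv ≫ φ.f (n + 1)) sq.w
      simp only [cell, comp_f, mkHomFromSingle_f, Category.assoc, Iso.inv_hom_id_assoc] at h1
      have h2 := congr_arg (fun φ => (doubleXIso₀ _ hR).inv ≫ φ) (b.comm n (n + 1))
      simp only [double_d _ hR (show n ≠ n + 1 by simp), Category.assoc, Category.id_comp,
        Iso.inv_hom_id_assoc] at h2
      rw [← ModuleCat.comp_apply, ← ModuleCat.comp_apply, Category.assoc, Category.assoc, h1, h2])
  refine ⟨⟨⟨mkHomFromDouble hR (by simp) (elt x) (elt x ≫ X.d n (n + 1)) (by simp) (by simp),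
    ?_, ?_⟩⟩⟩
  · apply from_single_hom_ext
    simp only [cell, comp_f, mkHomFromSingle_f, mkHomFromDouble_f₁, Category.assoc,
      Iso.inv_hom_id_assoc]
    rw [← Iso.eq_inv_comp]
    ext
    simpa using hx
  · apply from_double_hom_ext
    · simp only [comp_f, mkHomFromDouble_f₀, Category.assoc]
      rw [← Iso.eq_inv_comp]
      ext
      simpa using hy
    · have h2 : (doubleXIso₀ _ hR).inv ≫ b.f n ≫ Y.d n (n + 1) =
          (doubleXIso₁ _ hR (by simp)).inv ≫ b.f (n + 1) := by
        rw [b.comm, double_d _ hR (by simp)]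
        simp only [Category.assoc, Category.id_comp, Iso.inv_hom_id_assoc]
      have h3 : elt x ≫ p.f n = (doubleXIso₀ _ hR).inv ≫ b.f n := by
        ext
        simpa using hy
      simp only [comp_f, mkHomFromDouble_f₁, Category.assoc]
      rw [← Iso.eq_inv_comp, ← h2, ← p.comm, ← Category.assoc, h3, Category.assoc]

lemma quasiIso_of_rlp (hp : (cells R).rlp p) : QuasiIso p := by
  have hsurj : ∀ n, Function.Surjective (p.f n) := by
    intro n y
    obtain ⟨z, hz, hz'⟩ := exists_of_rlp p hp (n + 1) (Y.d n (n + 1) y) 0 (by simp) (by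
      rw [map_zero, ← ModuleCat.comp_apply, Y.d_comp_d]; rfl)
    have e : n + 1 + 1 = n + 2 := by ring
    obtain ⟨x, -, hx⟩ := exists_of_rlp p hp n y z (by rw [← e]; exact hz) hz'
    exact ⟨x, hx⟩
  have : ∀ n, Epi (p.f n) := fun n => (ModuleCat.epi_iff_surjective _).2 (hsurj n)
  have : Epi p := HomologicalComplex.epi_of_epi_f _ this
  let S : ShortComplex (CochainComplex (ModuleCat.{u} R) ℤ) :=
    ShortComplex.mk (kernel.ι p) p (by simp)
  have hS : S.ShortExact :=
    { exact := S.exact_of_f_is_kernel (kernelIsKernel p)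
      mono_f := by dsimp [S]; infer_instance
      epi_g := by dsimp [S]; infer_instance }
  have hSn (n : ℤ) := (ShortComplex.moduleCat_exact_iff _).1
    (hS.exact.map (eval (ModuleCat.{u} R) (ComplexShape.up ℤ) n))
  have hinj (n : ℤ) : Function.Injective (S.f.f n) := by
    have := hS.mono_f
    exact (ModuleCat.mono_iff_injective _).1 inferInstance
  have e1 (a b : ℤ) (x : S.X₁.X a) : S.f.f b (S.X₁.d a b x) = S.X₂.d a b (S.f.f a x) := by
    rw [← ModuleCat.comp_apply, ← ModuleCat.comp_apply, S.f.comm]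
  have e2 (a : ℤ) (x : S.X₁.X a) : p.f a (S.f.f a x) = 0 := by
    rw [← ModuleCat.comp_apply, ← comp_f]
    simp [S]
  have key (n : ℤ) (x : S.X₁.X (n + 1)) (hx : S.X₁.d (n + 1) (n + 2) x = 0) :
      ∃ w' : S.X₁.X n, S.X₁.d n (n + 1) w' = x := by
    obtain ⟨w, hw, hw'⟩ := exists_of_rlp p hp n 0 (S.f.f (n + 1) x)
      ((e1 _ _ x).symm.trans (by rw [hx, map_zero])) ((e2 _ x).trans (map_zero _).symm)
    obtain ⟨w', hw'⟩ := hSn n w hw'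
    refine ⟨w', hinj _ ((e1 _ _ _).trans ?_)⟩
    exact (congr_arg (S.X₂.d n (n + 1)) hw').trans hw
  have hac : S.X₁.Acyclic := by
    intro m
    obtain ⟨n, rfl⟩ : ∃ n, n + 1 = m := ⟨m - 1, by ring⟩
    rw [S.X₁.exactAt_iff' n (n + 1) (n + 2) (by simp) (by simp; ring),
      ShortComplex.moduleCat_exact_iff]
    exact fun x hx => key n x hx
  rw [quasiIso_iff]
  intro n
  rw [quasiIsoAt_iff_isIso_homologyMap]
  have z1 (n : ℤ) : IsZero (S.X₁.homology n) := (exactAt_iff_isZero_homology _ _).1 (hac n)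
  have m : Mono (homologyMap S.g n) := (hS.homology_exact₂ n).mono_g ((z1 n).eq_of_src _ _)
  have e : Epi (homologyMap S.g n) :=
    (hS.homology_exact₃ n (n + 1) (by simp)).epi_f ((z1 _).eq_of_tgt _ _)
  exact isIso_of_mono_of_epi (homologyMap S.g n)

open CochainComplex CochainComplex.HomComplex in
lemma delta_snd {A : CochainComplex (ModuleCat.{u} R) ℤ} :
    δ (-1) 0 (mappingCocone.snd (𝟙 A)) = - Cochain.ofHom (mappingCocone.fst (𝟙 A)) := by
  have : mappingCocone.snd (𝟙 A) =
      mappingCocone.descCochain (𝟙 A) (0 : Cochain A A (-1)) (Cochain.ofHom (𝟙 A)) (by simp) := by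
    ext a b hab
    rw [← Category.id_comp ((mappingCocone.descCochain (𝟙 A) _ _ _).v a b hab),
      ← mappingCocone.id_X (𝟙 A) a b hab, Preadditive.add_comp, Category.assoc, Category.assoc]
    simp
  rw [this, mappingCocone.δ_descCochain _ _ _ _ 1 (by simp)]
  simp

open CochainComplex in
lemma cocone_d {A : CochainComplex (ModuleCat.{u} R) ℤ} (m n k : ℤ) (h : m + 1 = n)
    (h' : n + 1 = k) (x : (mappingCocone (𝟙 A)).X n) :
    A.d m n ((mappingCocone.snd (𝟙 A)).v n m (by lia) x) +
        (mappingCocone.snd (𝟙 A)).v k n (by lia) ((mappingCocone (𝟙 A)).d n k x) =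
      - (mappingCocone.fst (𝟙 A)).f n x := by
  subst h'
  have := HomComplex.Cochain.congr_v (delta_snd (A := A)) n n (by simp)
  rw [HomComplex.δ_v (-1) 0 (by simp) _ n n _ m (n + 1) (by lia) rfl] at this
  simpa using congr($this x)

open CochainComplex in
lemma cocone_ext {A : CochainComplex (ModuleCat.{u} R) ℤ} (m n : ℤ) (h : m + 1 = n)
    (x y : (mappingCocone (𝟙 A)).X n)
    (h₁ : (mappingCocone.fst (𝟙 A)).f n x = (mappingCocone.fst (𝟙 A)).f n y)
    (h₂ : (mappingCocone.snd (𝟙 A)).v n m (by lia) x =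
      (mappingCocone.snd (𝟙 A)).v n m (by lia) y) : x = y := by
  have key (x : (mappingCocone (𝟙 A)).X n) := congr($(mappingCocone.id_X (𝟙 A) n m (by lia)) x)
  simp only [ModuleCat.hom_add, ModuleCat.hom_comp, LinearMap.add_apply, LinearMap.comp_apply]
    at key
  rw [← ModuleCat.id_apply _ x, ← ModuleCat.id_apply _ y]
  refine (key x).symm.trans (Eq.trans ?_ (key y))
  erw [h₁, h₂]

open CochainComplex in
lemma rlp_cocone {A : CochainComplex (ModuleCat.{u} R) ℤ} (hA : A.Acyclic) :
    (cells R).rlp (mappingCocone.fst (𝟙 A)) := by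
  apply rlp_of_exists
  intro n y z hz hyz
  have h1 := cocone_d n (n + 1) (n + 2) rfl (by ring) z
  rw [hz, map_zero, add_zero, hyz] at h1
  have hex (c : A.X n) (hc : A.d n (n + 1) c = 0) : ∃ a : A.X (n - 1), A.d (n - 1) n a = c :=
    (ShortComplex.moduleCat_exact_iff _).1
      ((A.exactAt_iff' (n - 1) n (n + 1) (by simp) (by simp)).1 (hA n)) c hc
  obtain ⟨a, ha⟩ := hex (-((mappingCocone.snd (𝟙 A)).v (n + 1) n (by lia) z + y)) (by
    rw [map_neg, map_add, h1]
    simp)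
  let x : (mappingCocone (𝟙 A)).X n := (mappingCocone.inl (𝟙 A)).v n n (by lia) y +
    (mappingCocone.inr (𝟙 A)).1.v (n - 1) n (by lia) a
  have hfst : (mappingCocone.fst (𝟙 A)).f n x = y := by
    rw [map_add, ← ModuleCat.comp_apply, ← ModuleCat.comp_apply, mappingCocone.inl_v_fst_f,
      mappingCocone.inr_v_fst_f]
    simp
  have hsnd : (mappingCocone.snd (𝟙 A)).v n (n - 1) (by lia) x = a := by
    rw [map_add, ← ModuleCat.comp_apply, ← ModuleCat.comp_apply, mappingCocone.inl_v_snd_v,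
      mappingCocone.inr_v_snd_v]
    simp
  refine ⟨x, cocone_ext n (n + 1) rfl _ _ ?_ ?_, hfst⟩
  · rw [hyz, ← ModuleCat.comp_apply, ← (mappingCocone.fst (𝟙 A)).comm, ModuleCat.comp_apply, hfst]
  · have h2 := cocone_d (n - 1) n (n + 1) (by lia) rfl x
    rw [hsnd, hfst, ha, neg_add, add_assoc, neg_add_eq_iff_eq_add] at h2
    rw [add_comm] at h2
    exact add_right_cancel h2

lemma isKProjective_of_llp (P : CochainComplex (ModuleCat.{u} R) ℤ)
    (hP : (cells R).rlp.llp (0 : 0 ⟶ P)) : P.IsKProjective where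
  nonempty_homotopy_zero {A} f hA := by
    have := hP _ (rlp_cocone hA)
    have sq : CommSq (0 : 0 ⟶ CochainComplex.mappingCocone (𝟙 A)) (0 : 0 ⟶ P)
      (CochainComplex.mappingCocone.fst (𝟙 A)) f := ⟨by simp⟩
    have hz : Nonempty (Homotopy (CochainComplex.mappingCocone.fst (𝟙 A)) 0) :=
      ⟨(CochainComplex.HomComplex.Cochain.equivHomotopy _ _).symm
        ⟨-(CochainComplex.mappingCocone.snd (𝟙 A)), by simp [delta_snd]⟩⟩
    exact ⟨(Homotopy.ofEq sq.fac_right.symm).trans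
      ((hz.some.compLeft sq.lift).trans (Homotopy.ofEq (by simp)))⟩

theorem exists_kProjective_resolution (X : CochainComplex (ModuleCat.{u} R) ℤ) :
    ∃ (P : CochainComplex (ModuleCat.{u} R) ℤ) (p : P ⟶ X), P.IsKProjective ∧ QuasiIso p := by
  let h := MorphismProperty.factorizationData (cells R).rlp.llp (cells R).rlp (0 : 0 ⟶ X)
  refine ⟨h.Z, h.p, isKProjective_of_llp _ ?_, quasiIso_of_rlp _ h.hp⟩
  rw [← (isZero_zero _).eq_of_src h.i 0]
  exact h.hi

end KProj

/-! ### Total left derived functors on unbounded derived categories of modules -/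

section Derived

open CategoryTheory CategoryTheory.Limits

instance (R : Type u) [Ring R] : HasDerivedCategory (ModuleCat.{u} R) :=
  HasDerivedCategory.standard _

section LeftDerived
variable {R : Type u} [Ring R] {D : Type*} [Category D]
  (F : HomotopyCategory (ModuleCat.{u} R) (ComplexShape.up ℤ) ⥤ D)

lemma hasPointwiseRightKanExtensionAt_of_isKProjective
    (P : CochainComplex (ModuleCat.{u} R) ℤ) [P.IsKProjective] :
    DerivedCategory.Qh.HasPointwiseRightKanExtensionAt F
      (DerivedCategory.Qh.obj ((HomotopyCategory.quotient _ _).obj P)) := by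
  have h (L) := CochainComplex.IsKProjective.Qh_map_bijective P L
  have hi : IsInitial (StructuredArrow.mk
      (𝟙 (DerivedCategory.Qh.obj ((HomotopyCategory.quotient _ _).obj P)))) :=
    IsInitial.ofUniqueHom
      (fun Y => StructuredArrow.homMk ((h Y.right).2 Y.hom).choose (by
        have := ((h Y.right).2 Y.hom).choose_spec
        dsimp
        rw [this, Category.id_comp]))
      (fun Y m => by
        ext
        apply (h Y.right).1
        have h1 := StructuredArrow.w m
        have h2 := ((h Y.right).2 Y.hom).choose_spec
        dsimp at h1 ⊢
        rw [Category.id_comp] at h1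
        exact h1.trans h2.symm)
  have : HasInitial (StructuredArrow
      (DerivedCategory.Qh.obj ((HomotopyCategory.quotient _ _).obj P))
      DerivedCategory.Qh) := hi.hasInitial
  exact ⟨⟨_, limitOfDiagramInitial hi _⟩⟩

instance : F.HasPointwiseLeftDerivedFunctor
    (HomotopyCategory.quasiIso (ModuleCat.{u} R) (ComplexShape.up ℤ)) := by
  intro X
  obtain ⟨X, rfl⟩ := HomotopyCategory.quotient_obj_surjective X
  obtain ⟨P, p, hP, hp⟩ := exists_kProjective_resolution X
  rw [← Functor.hasPointwiseLeftDerivedFunctorAt_iff_of_mem F _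
    ((HomotopyCategory.quotient _ _).map p) (by
      rw [HomotopyCategory.quotient_map_mem_quasiIso_iff]; exact hp),
    Functor.hasPointwiseLeftDerivedFunctorAt_iff F DerivedCategory.Qh]
  exact hasPointwiseRightKanExtensionAt_of_isKProjective F P

end LeftDerived

/-- The total left derived functor `D(R) ⥤ D(A)` of an additive functor `F : R-Mod ⥤ A`: the
left derived functor of `F`, extended to complexes up to homotopy, with respect to
quasi-isomorphisms. -/
def leftDerived {R : Type u} [Ring R] {A : Type*} [Category A] [Abelian A]
    [HasDerivedCategory A] (F : ModuleCat.{u} R ⥤ A) [F.Additive] :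
    DerivedCategory (ModuleCat.{u} R) ⥤ DerivedCategory A :=
  (F.mapHomotopyCategory (ComplexShape.up ℤ) ⋙ DerivedCategory.Qh).totalLeftDerived
    DerivedCategory.Qh (HomotopyCategory.quasiIso (ModuleCat.{u} R) (ComplexShape.up ℤ))

variable {k V H : Type u} [Field k] [AddCommGroup V] [Module k V] [Group H]
  (ρ : Representation k H V)

/-- The (unbounded) derived category of `H`-equivariant quasi-coherent sheaves on `Spec C`, where
`C` is the coinvariant algebra of the representation `ρ` of `H`. -/
abbrev EquivariantSheaf : Type (u + 1) :=
  DerivedCategory (EquivariantModule (CoinvariantAlgebra ρ) H)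

/-- `F` descends to `Spec k`: it is isomorphic to the pullback of a complex of vector spaces along
`Spec(C)/H → Spec k`. -/
def Descends (F : EquivariantSheaf ρ) : Prop :=
  (pullback k (CoinvariantAlgebra ρ) H).mapDerivedCategory.essImage F

/-- The derived fibre functor `F ↦ i^*(F) = k ⊗ᴸ_C F`, with values in complexes of representations
of `H`, at the point `i : Spec k → Spec C` given by the augmentation of `C`. -/
def derivedFiber : EquivariantSheaf ρ ⥤ DerivedCategory (Rep.{u} k H) :=
  leftDerived (fiber (CoinvariantAlgebra.ε ρ) (CoinvariantAlgebra.ε_smul ρ))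

/-- `H` acts trivially on the complex of representations `E`: it is isomorphic, in the derived
category of representations, to a complex of trivial representations. -/
def IsTrivialAction (E : DerivedCategory (Rep.{u} k H)) : Prop :=
  (Rep.trivialFunctor.{u} k H).mapDerivedCategory.essImage E

end Derived

end

end CoinvariantDescent

/-!
Write `m` for the kernel of the augmentation `ε : C → k`. An invariant of `C` lifts to an invariant
polynomial by averaging, so `C ^ H = k` and `m` contains no nonzero invariant. By Benson's lemma
(`prod_eq_zero_of_invariants_eq_zero`) this forces `m ^ |H| = 0`, so `m` is the only maximal ideal.
The rest of the argument only uses that `m` is nilpotent and contains no nonzero invariant.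

Pullback `W ↦ C ⊗ W` is left adjoint to the exact functor of `H`-invariants, hence preserves
K-projective complexes, and the fibre of `C ⊗ W` is `W` with the trivial action. So the derived
fibre of a sheaf that descends is a complex with trivial action
(`essImage_trivialFunctor_leftDerived_fiber`).

Conversely, let `P` be a K-projective resolution of `F` with projective terms; these are then
projective over `C`, since `C ⋊ H` is free over `C`. The derived fibre is `P / m P`, and triviality
of the action is only used on its homology. The claim is that the counit `C ⊗ P ^ H → P` is a
quasi-isomorphism (`quasiIso_counit`); then `F` is the pullback of the complex `P ^ H`.

Filter `P` by the subcomplexes `m ^ i P`. By flatness the graded pieces are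
`m ^ i / m ^ (i + 1) ⊗ P / m P`, which is made explicit by choosing bases of `m ^ i / m ^ (i + 1)`
(`IsSymbolBasis`, `IsSymbolFlat`). For `i > 0` the representation `m ^ i / m ^ (i + 1)` has no
invariants, and `H` acts trivially on the homology of `P / m P`, so the homology of the `i`-th piece
has no invariants. As the filtration is finite, the invariants of `m P` are acyclic
(`isInvariantExact`), in other words `P ^ H → (P / m P) ^ H` is a quasi-isomorphism. Consequently
the homology of `P / m P` is represented by invariant cycles of `P`. This gives surjectivity of the
counit on homology (`mem_range_sup_invariantCycles`), strictness of the differential of `P` for the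
filtration (`exists_mem_pow_map_eq`), and, by comparing symbols, injectivity of the counit on
homology (`exists_baseChange_eq`).

The derived functors are computed from K-projective complexes (`leftDerivedObjIso`). That the
complexes provided by the small object argument have projective terms is seen by lifting their
identity along a surjection of contractible complexes (`projective_X_of_llp`).
-/

namespace CoinvariantDescent

/-! ### Nilpotence of the augmentation ideal -/

section Nilpotence

open scoped Pointwise

variable {C H : Type*} [CommRing C] [Group H] [Fintype H] [MulSemiringAction H C]

/-- Benson's lemma, in the form used here: a product of `|H|` elements of an `H`-stable ideal
without nonzero invariants vanishes. The identity `∑ g, ∏ h, (g h f_h - f_h) = 0` holds because the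
factor of index `h = g⁻¹` is zero; when it is expanded, all terms but `± |H| ∏ h, f_h` have an
invariant factor in the ideal. -/
lemma prod_eq_zero_of_invariants_eq_zero (hH : IsUnit (Fintype.card H : C)) (m : Ideal C)
    (hm : ∀ (h : H), ∀ c ∈ m, h • c ∈ m)
    (hinv : ∀ c ∈ m, (∀ h : H, h • c = c) → c = 0) (f : H → C) (hf : ∀ h, f h ∈ m) :
    ∏ h, f h = 0 := by
  classical
  have h1 : ∑ g : H, ∏ h : H, ((g * h) • f h - f h) = 0 :=
    Finset.sum_eq_zero fun g _ => Finset.prod_eq_zero (Finset.mem_univ g⁻¹) (by simp)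
  simp only [sub_eq_add_neg, Finset.prod_add] at h1
  rw [Finset.sum_comm, Finset.sum_eq_single ∅] at h1
  · simp only [Finset.prod_empty, Finset.sdiff_empty, one_mul, Finset.sum_const, Finset.card_univ,
      Finset.prod_neg, nsmul_eq_mul] at h1
    have hu : IsUnit ((Fintype.card H : C) * (-1) ^ Fintype.card H) :=
      hH.mul (isUnit_one.neg.pow _)
    rwa [← mul_assoc, hu.mul_right_eq_zero] at h1
  · intro s _ hs
    rw [← Finset.sum_mul]
    have : ∑ g : H, ∏ h ∈ s, (g * h) • f h = 0 := by
      simp only [mul_smul, ← Finset.smul_prod']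
      refine hinv _ (Ideal.sum_mem _ fun g _ => hm _ _ ?_) fun h => ?_
      · obtain ⟨a, ha⟩ := Finset.nonempty_iff_ne_empty.2 hs
        exact Ideal.mem_of_dvd _ (Finset.dvd_prod_of_mem _ ha) (hm _ _ (hf a))
      · rw [Finset.smul_sum]
        exact Fintype.sum_equiv (Equiv.mulLeft h) _ _ fun g => by simp [mul_smul]
    rw [this, zero_mul]
  · simp

lemma pow_card_eq_bot_of_invariants_eq_zero (hH : IsUnit (Fintype.card H : C)) (m : Ideal C)
    (hm : ∀ (h : H), ∀ c ∈ m, h • c ∈ m)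
    (hinv : ∀ c ∈ m, (∀ h : H, h • c = c) → c = 0) : m ^ Fintype.card H = ⊥ := by
  have h1 : m ^ Fintype.card H = ∏ _h : H, Ideal.span (m : Set C) := by
    simp
  rw [h1, Ideal.prod_span, Ideal.span_eq_bot]
  intro x hx
  obtain ⟨f, hf, rfl⟩ := (Set.mem_fintype_prod _ _).1 hx
  exact prod_eq_zero_of_invariants_eq_zero hH m hm hinv f hf

end Nilpotence

section CoinvariantAlgebra

open CoinvariantAlgebra

variable {k V H : Type u} [Field k] [AddCommGroup V] [Module k V] [Group H]
  (ρ : Representation k H V)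

lemma CoinvariantAlgebra.mk_eq_zero_of_invariant (f : Poly ρ) (hf : ∀ h : H, h • f = f)
    (h0 : Poly.eval₀ ρ f = 0) : mk ρ f = 0 :=
  Ideal.Quotient.eq_zero_iff_mem.2 (Ideal.subset_span ⟨hf, h0⟩)

variable [CharZero k] [Finite H]

/-- An invariant of the coinvariant algebra lifts to an invariant polynomial by averaging, and this
differs from its constant term by a generator of the ideal. -/
lemma CoinvariantAlgebra.eq_algebraMap_of_invariant (c : CoinvariantAlgebra ρ)
    (hc : ∀ h : H, h • c = c) : c = algebraMap k _ (ε ρ c) := by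
  have := Fintype.ofFinite H
  obtain ⟨f, rfl⟩ := mk_surjective ρ c
  let a : k := (Fintype.card H : k)⁻¹
  let f' : Poly ρ := a • ∑ h : H, h • f
  have ha : a * Fintype.card H = 1 :=
    inv_mul_cancel₀ (Nat.cast_ne_zero.2 Fintype.card_ne_zero)
  have hf' : mk ρ f' = mk ρ f := by
    simp only [f', map_smul, map_sum, ← smul_mk, hc, Finset.sum_const, Finset.card_univ]
    rw [← Nat.cast_smul_eq_nsmul k, smul_smul, ha, one_smul]
  have hinv (h : H) : h • f' = f' := by
    simp only [f']
    rw [smul_comm, Finset.smul_sum]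
    congr 1
    exact Fintype.sum_equiv (Equiv.mulLeft h) _ _ fun g => by simp [mul_smul]
  have h0 := mk_eq_zero_of_invariant ρ (f' - algebraMap k _ (Poly.eval₀ ρ f'))
    (fun h => by rw [smul_sub, hinv, smul_algebraMap]) (by simp)
  rw [map_sub, sub_eq_zero, AlgHom.commutes, ← ε_mk, hf'] at h0
  exact h0

lemma CoinvariantAlgebra.ker_ε_pow : ∃ n, RingHom.ker (ε ρ) ^ n = ⊥ := by
  have := Fintype.ofFinite H
  refine ⟨Fintype.card H, pow_card_eq_bot_of_invariants_eq_zero ?_ _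
    (fun h c hc => ?_) (fun c hc hinv => ?_)⟩
  · rw [← map_natCast (algebraMap k (CoinvariantAlgebra ρ))]
    exact (IsUnit.mk0 _ (Nat.cast_ne_zero.2 Fintype.card_ne_zero)).map _
  · rwa [RingHom.mem_ker, ε_smul]
  · rw [eq_algebraMap_of_invariant ρ c hinv, RingHom.mem_ker.1 hc, map_zero]

lemma CoinvariantAlgebra.bijective_algebraMap_fixedPoints :
    Function.Bijective (algebraMap k (FixedPoints.subalgebra k (CoinvariantAlgebra ρ) H)) := by
  refine ⟨fun a b hab => ?_, fun c => ⟨ε ρ c, Subtype.ext ?_⟩⟩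
  · have := congr(ε ρ ($hab : CoinvariantAlgebra ρ))
    simpa using this
  · exact (eq_algebraMap_of_invariant ρ c.1 c.2).symm

/-- A nilpotent maximal ideal is the unique maximal ideal. -/
lemma isMaximal_iff_eq_of_pow_eq_bot {C : Type*} [CommRing C] {m : Ideal C} (hm : m.IsMaximal)
    {n : ℕ} (hn : m ^ n = ⊥) (m' : Ideal C) : m'.IsMaximal ↔ m' = m := by
  refine ⟨fun h => (hm.eq_of_le h.ne_top fun c hc => ?_).symm, fun h => h ▸ hm⟩
  refine h.isPrime.mem_of_pow_mem n ?_
  have := Ideal.pow_mem_pow hc n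
  rw [hn, Ideal.mem_bot] at this
  exact this ▸ zero_mem _

lemma CoinvariantAlgebra.isMaximal_iff (m : Ideal (CoinvariantAlgebra ρ)) :
    m.IsMaximal ↔ m = RingHom.ker (ε ρ) :=
  isMaximal_iff_eq_of_pow_eq_bot (RingHom.ker_isMaximal_of_surjective _ fun a =>
    ⟨algebraMap k _ a, by simp⟩) (ker_ε_pow ρ).choose_spec m

end CoinvariantAlgebra

/-! ### Symbols and averaging -/

noncomputable section

open scoped TensorProduct

section Symbols

variable {k C : Type u} [Field k] [CommRing C] [Algebra k C] (ε : C →ₐ[k] k)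

/-- A family `u` of elements of `m ^ i`, for `m` the kernel of `ε`, whose classes form a basis of
the `k`-vector space `m ^ i / m ^ (i + 1)`. -/
structure IsSymbolBasis (i : ℕ) {B : Type u} (u : B → C) : Prop where
  mem (b : B) : u b ∈ RingHom.ker ε ^ i
  exists_sub_mem (c : C) (hc : c ∈ RingHom.ker ε ^ i) :
    ∃ a : B →₀ k, c - a.sum (fun b r => r • u b) ∈ RingHom.ker ε ^ (i + 1)
  eq_zero (a : B →₀ k) (ha : a.sum (fun b r => r • u b) ∈ RingHom.ker ε ^ (i + 1)) : a = 0

lemma exists_isSymbolBasis (i : ℕ) : ∃ (B : Type u) (u : B → C), IsSymbolBasis ε i u := by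
  let J : Submodule k C := (RingHom.ker ε ^ i).restrictScalars k
  let J' : Submodule k C := (RingHom.ker ε ^ (i + 1)).restrictScalars k
  let W : Submodule k (C ⧸ J') := J.map J'.mkQ
  let b := Module.Basis.ofVectorSpace k W
  have hb (x : Module.Basis.ofVectorSpaceIndex k W) : ∃ c ∈ J, J'.mkQ c = b x := (b x).2
  choose u hu hu' using hb
  have key (a : Module.Basis.ofVectorSpaceIndex k W →₀ k) :
      J'.mkQ (a.sum fun b r => r • u b) = (Finsupp.linearCombination k b a : W) := by
    rw [Finsupp.linearCombination_apply, Finsupp.sum, Finsupp.sum, map_sum, Submodule.coe_sum]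
    simp [-Submodule.mkQ_apply, hu']
  refine ⟨_, u, hu, fun c hc => ?_, fun a ha => ?_⟩
  · refine ⟨b.repr ⟨J'.mkQ c, c, hc, rfl⟩, ?_⟩
    refine (Submodule.Quotient.mk_eq_zero J').1 ?_
    change J'.mkQ _ = 0
    rw [map_sub, key, b.linearCombination_repr, sub_self]
  · have : J'.mkQ (a.sum fun b r => r • u b) = 0 := (Submodule.Quotient.mk_eq_zero J').2 ha
    rw [key, ZeroMemClass.coe_eq_zero] at this
    rw [← b.repr_linearCombination a, this, map_zero]

variable {ε} {i : ℕ} {B : Type u} {u : B → C} {M : Type*} [AddCommGroup M] [Module C M]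

lemma sub_algebraMap_mem_ker (c : C) : c - algebraMap k C (ε c) ∈ RingHom.ker ε := by
  simp [RingHom.mem_ker]

lemma IsSymbolBasis.exists_sub_mem_smul_top (hu : IsSymbolBasis ε i u) (x : M)
    (hx : x ∈ RingHom.ker ε ^ i • (⊤ : Submodule C M)) :
    ∃ p : B →₀ M, x - p.sum (fun b y => u b • y) ∈
      RingHom.ker ε ^ (i + 1) • (⊤ : Submodule C M) := by
  induction hx using Submodule.smul_induction_on' with
  | smul c hc x _ =>
    obtain ⟨a, ha⟩ := hu.exists_sub_mem c hc
    refine ⟨a.mapRange (fun r => algebraMap k C r • x) (by simp), ?_⟩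
    rw [Finsupp.sum_mapRange_index (by simp)]
    convert Submodule.smul_mem_smul ha (Submodule.mem_top : x ∈ ⊤) using 1
    rw [sub_smul, Finsupp.sum, Finsupp.sum, Finset.sum_smul]
    simp only [Algebra.smul_def, smul_smul, mul_comm]
  | add x _ y _ hx hy =>
    obtain ⟨p, hp⟩ := hx
    obtain ⟨q, hq⟩ := hy
    refine ⟨p + q, ?_⟩
    classical
    rw [Finsupp.sum_add_index (by simp) (by simp [smul_add]), add_sub_add_comm]
    exact add_mem hp hq

variable (ε M) in
/-- The consequence of flatness of `M` over `C` that, for all `i`, the natural map from the tensor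
product over `k` of `m ^ i / m ^ (i + 1)` and `M / m M` to `m ^ i M / m ^ (i + 1) M` is injective:
in terms of a basis `u_b` of `m ^ i / m ^ (i + 1)`, if `∑ u_b p_b` lies in `m ^ (i + 1) M`, then all
`p_b` lie in `m M`. -/
def IsSymbolFlat : Prop :=
  ∀ ⦃i : ℕ⦄ ⦃B : Type u⦄ ⦃u : B → C⦄, IsSymbolBasis ε i u → ∀ p : B →₀ M,
    p.sum (fun b y => u b • y) ∈ RingHom.ker ε ^ (i + 1) • (⊤ : Submodule C M) →
      ∀ b, p b ∈ RingHom.ker ε • (⊤ : Submodule C M)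

lemma IsSymbolBasis.mem_ker (hu : IsSymbolBasis ε i u) (p : B →₀ C)
    (hp : p.sum (fun b y => u b * y) ∈ RingHom.ker ε ^ (i + 1)) (b : B) :
    p b ∈ RingHom.ker ε := by
  have h := hu.eq_zero (p.mapRange ε (map_zero _)) (by
    rw [Finsupp.sum_mapRange_index (by simp)]
    rw [← sub_sub_cancel (p.sum fun b y => u b * y) (p.sum _)]
    refine sub_mem hp ?_
    rw [Finsupp.sum, Finsupp.sum, ← Finset.sum_sub_distrib]
    refine sum_mem fun b _ => ?_
    rw [Algebra.smul_def, mul_comm _ (u b), ← mul_sub, pow_succ]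
    exact Ideal.mul_mem_mul (hu.mem b) (sub_algebraMap_mem_ker _))
  rw [RingHom.mem_ker]
  exact DFunLike.congr_fun h b

lemma apply_mem_of_mem_smul_top (J : Ideal C) {N : Type*} [AddCommGroup N] [Module C N]
    (f : M →ₗ[C] N) {x : M} (hx : x ∈ J • (⊤ : Submodule C M)) :
    f x ∈ J • (⊤ : Submodule C N) := by
  have := Submodule.mem_map_of_mem (f := f) hx
  rw [Submodule.map_smul''] at this
  exact Submodule.smul_mono le_rfl le_top this

lemma isSymbolFlat_of_projective [Module.Projective C M] : IsSymbolFlat ε M := by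
  intro i B u hu p hp b
  obtain ⟨s, hs⟩ := (Module.projective_def'.1 (inferInstance : Module.Projective C M))
  have hs' (x : M) : Finsupp.linearCombination C id (s x) = x := LinearMap.congr_fun hs x
  have key (j : M) : s (p b) j ∈ RingHom.ker ε := by
    refine hu.mem_ker (p.mapRange (fun x => s x j) (by simp)) ?_ b
    rw [Finsupp.sum_mapRange_index (by simp)]
    have := apply_mem_of_mem_smul_top _ (Finsupp.lapply j ∘ₗ s) hp
    rw [smul_eq_mul, Ideal.mul_top] at this
    convert this
    simp [Finsupp.sum]
  rw [← hs' (p b), Finsupp.linearCombination_apply]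
  exact sum_mem fun j _ => Submodule.smul_mem_smul (key j) Submodule.mem_top

end Symbols

section Averaging

instance {C H : Type*} [CommRing C] [Group H] [MulSemiringAction H C] : SMulDistribClass H C C :=
  ⟨fun h c x => smul_mul' h c x⟩

lemma algebraMap_inv_smul_sum_const (k : Type*) {C H M : Type*} [Field k] [CharZero k]
    [CommRing C] [Algebra k C] [Group H] [Fintype H] [AddCommGroup M] [Module C M] (x : M) :
    algebraMap k C (Fintype.card H : k)⁻¹ • ∑ _h : H, x = x := by
  rw [Finset.sum_const, Finset.card_univ, ← Nat.cast_smul_eq_nsmul C, smul_smul,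
    ← map_natCast (algebraMap k C), ← map_mul,
    inv_mul_cancel₀ (Nat.cast_ne_zero.2 Fintype.card_ne_zero), map_one, one_smul]

lemma smul_mem_smul_top {C H M : Type*} [CommRing C] [Group H] [MulSemiringAction H C]
    [AddCommGroup M] [Module C M] [DistribMulAction H M] [SMulDistribClass H C M] {J : Ideal C}
    (hJ : ∀ (h : H), ∀ c ∈ J, h • c ∈ J) {x : M} (hx : x ∈ J • (⊤ : Submodule C M)) (h : H) :
    h • x ∈ J • (⊤ : Submodule C M) := by
  induction hx using Submodule.smul_induction_on' with
  | smul c hc x _ =>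
    rw [smul_distrib_smul]
    exact Submodule.smul_mem_smul (hJ h c hc) Submodule.mem_top
  | add x _ y _ hx hy =>
    rw [smul_add]
    exact add_mem hx hy

variable (k C H : Type*) [Field k] [CommRing C] [Algebra k C] [Group H] [Fintype H]
  {M N : Type*} [AddCommGroup M] [Module C M] [DistribMulAction H M]
  [AddCommGroup N] [Module C N] [DistribMulAction H N]

/-- The averaging operator `x ↦ |H|⁻¹ ∑ h, h x`. The scalar `|H|⁻¹` acts through `C`, so that no
separate `k`-module structure on `M` is needed. -/
def average : M →+ M :=
  (DistribSMul.toAddMonoidHom M (algebraMap k C (Fintype.card H : k)⁻¹)).comp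
    (∑ h : H, DistribSMul.toAddMonoidHom M h)

variable {C H}

lemma average_apply (x : M) :
    average k C H x = algebraMap k C (Fintype.card H : k)⁻¹ • ∑ h : H, h • x := by
  simp [average, Finset.smul_sum]

lemma map_average (f : M →ₗ[C] N) (hf : ∀ (h : H) x, f (h • x) = h • f x) (x : M) :
    f (average k C H x) = average k C H (f x) := by
  simp [average_apply, hf]

lemma average_eq_self [CharZero k] (x : M) (hx : ∀ h : H, h • x = x) :
    average k C H x = x := by
  simp only [average_apply, hx, algebraMap_inv_smul_sum_const k]

lemma average_sub_self_mem [CharZero k] (S : Submodule C M) (x : M)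
    (hx : ∀ h : H, h • x - x ∈ S) : average k C H x - x ∈ S := by
  have : average k C H x - x =
      algebraMap k C (Fintype.card H : k)⁻¹ • ∑ h : H, (h • x - x) := by
    rw [Finset.sum_sub_distrib, smul_sub, algebraMap_inv_smul_sum_const, average_apply]
  rw [this]
  exact Submodule.smul_mem _ _ (sum_mem fun h _ => hx h)

variable [MulSemiringAction H C] [SMulDistribClass H C M]

lemma average_mem {J : Ideal C} (hJ : ∀ (h : H), ∀ c ∈ J, h • c ∈ J) {x : M}
    (hx : x ∈ J • (⊤ : Submodule C M)) : average k C H x ∈ J • (⊤ : Submodule C M) := by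
  rw [average_apply]
  exact Submodule.smul_mem _ _ (sum_mem fun h _ => smul_mem_smul_top hJ hx h)

/-- For the averaging operator `e`, one has `e(c x) - e(c) x = |H|⁻¹ ∑ h, h(c) (h(x) - x)`. -/
lemma average_smul_sub_mem {J : Ideal C} (hJ : ∀ (h : H), ∀ c ∈ J, h • c ∈ J) (S : Submodule C M)
    {c : C} (hc : c ∈ J) (x : M) (hx : ∀ h : H, h • x - x ∈ S) :
    average k C H (c • x) - average k C H c • x ∈ J • S := by
  have : average k C H (c • x) - average k C H c • x =
      algebraMap k C (Fintype.card H : k)⁻¹ • ∑ h : H, (h • c) • (h • x - x) := by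
    rw [average_apply, average_apply, smul_assoc, Finset.sum_smul]
    simp only [smul_distrib_smul, smul_sub, Finset.sum_sub_distrib]
  rw [this]
  exact Submodule.smul_mem _ _ (sum_mem fun h _ => Submodule.smul_mem_smul (hJ h c hc) (hx h))

variable [SMulCommClass H k C]

lemma smul_average (h : H) (x : M) : h • average k C H x = average k C H x := by
  rw [average_apply, smul_distrib_smul, smul_algebraMap, Finset.smul_sum]
  congr 1
  exact Fintype.sum_equiv (Equiv.mulLeft h) _ _ fun g => by simp [mul_smul]

end Averaging

/-! ### The filtration by powers of the augmentation ideal -/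

section Core

variable {k C H : Type u} [Field k] [CommRing C] [Algebra k C] [Group H] [MulSemiringAction H C]
  {M₁ M₂ M₃ : Type*}
  [AddCommGroup M₁] [Module C M₁] [DistribMulAction H M₁]
  [AddCommGroup M₂] [Module C M₂] [DistribMulAction H M₂]
  [AddCommGroup M₃] [Module C M₃] [DistribMulAction H M₃]

variable (H) in
/-- `H` acts trivially on the homology of `M₁ / m → M₂ / m → M₃ / m`. -/
def IsTrivialOnFiberHomology (m : Ideal C) (d₁ : M₁ →ₗ[C] M₂) (d₂ : M₂ →ₗ[C] M₃) : Prop :=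
  ∀ p, d₂ p ∈ m • (⊤ : Submodule C M₃) →
    ∀ h : H, h • p - p ∈ LinearMap.range d₁ ⊔ m • (⊤ : Submodule C M₂)

variable (H) in
/-- Exactness of the `H`-invariants of `m M₁ → m M₂ → m M₃`. -/
def IsInvariantExact (m : Ideal C) (d₁ : M₁ →ₗ[C] M₂) (d₂ : M₂ →ₗ[C] M₃) : Prop :=
  ∀ x ∈ m • (⊤ : Submodule C M₂), (∀ h : H, h • x = x) → d₂ x = 0 →
    ∃ y ∈ m • (⊤ : Submodule C M₁), (∀ h : H, h • y = y) ∧ d₁ y = x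

variable (H) in
/-- The `C`-submodule generated by the invariant cycles. -/
def invariantCycles (d₂ : M₂ →ₗ[C] M₃) : Submodule C M₂ :=
  Submodule.span C {q | (∀ h : H, h • q = q) ∧ d₂ q = 0}

lemma invariantCycles_le_ker {C H : Type u} {M₂ M₃ : Type*} [CommRing C] [Group H] [AddCommGroup M₂]
    [Module C M₂] [DistribMulAction H M₂] [AddCommGroup M₃] [Module C M₃] (d₂ : M₂ →ₗ[C] M₃) :
    invariantCycles H d₂ ≤ LinearMap.ker d₂ :=
  Submodule.span_le.2 fun _ hq => hq.2

lemma pow_smul_range_sup (m : Ideal C) (d₁ : M₁ →ₗ[C] M₂) (i : ℕ) :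
    m ^ i • (LinearMap.range d₁ ⊔ m • (⊤ : Submodule C M₂)) =
      (m ^ i • (⊤ : Submodule C M₁)).map d₁ ⊔ m ^ (i + 1) • (⊤ : Submodule C M₂) := by
  rw [Submodule.smul_sup, ← Submodule.mul_smul, ← pow_succ, LinearMap.range_eq_map,
    Submodule.map_smul'']

variable {ε : C →ₐ[k] k}

lemma smul_mem_ker_pow (hε : ∀ (h : H) (c : C), ε (h • c) = ε c) (i : ℕ) (h : H) (c : C)
    (hc : c ∈ RingHom.ker ε ^ i) : h • c ∈ RingHom.ker ε ^ i := by
  have : RingHom.ker ε ^ i ≤ (RingHom.ker ε ^ i).comap (MulSemiringAction.toRingHom H C h) := by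
    refine le_trans ?_ (Ideal.le_comap_pow _ i)
    refine Ideal.pow_right_mono (fun c hc => ?_) i
    rw [RingHom.mem_ker] at hc
    simp [RingHom.mem_ker, hε, hc]
  exact this hc

/-- If `∑ u_b p_b` is a cycle modulo `m ^ (i + 1)`, then each `p_b` is a cycle modulo `m`. -/
lemma IsSymbolBasis.map_mem {i : ℕ} {B : Type u} {u : B → C} (hu : IsSymbolBasis ε i u)
    (hM₃ : IsSymbolFlat ε M₃) (d₂ : M₂ →ₗ[C] M₃) {x : M₂}
    (hx : d₂ x ∈ RingHom.ker ε ^ (i + 1) • (⊤ : Submodule C M₃)) (p : B →₀ M₂)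
    (hp : x - p.sum (fun b y => u b • y) ∈ RingHom.ker ε ^ (i + 1) • (⊤ : Submodule C M₂)) (b : B) :
    d₂ (p b) ∈ RingHom.ker ε • (⊤ : Submodule C M₃) := by
  refine hM₃ hu (p.mapRange d₂ (map_zero _)) ?_ b
  rw [Finsupp.sum_mapRange_index (by simp)]
  have := sub_mem hx (apply_mem_of_mem_smul_top _ d₂ hp)
  rw [map_sub, sub_sub_cancel] at this
  simpa [Finsupp.sum] using this

variable [Fintype H] [CharZero k] [SMulCommClass H k C]
  [SMulDistribClass H C M₁] [SMulDistribClass H C M₂] [SMulDistribClass H C M₃]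
  (hε : ∀ (h : H) (c : C), ε (h • c) = ε c)
  (hinv : ∀ c : C, ε c = 0 → (∀ h : H, h • c = c) → c = 0)
  {d₁ : M₁ →ₗ[C] M₂} {d₂ : M₂ →ₗ[C] M₃}
  (hd₁ : ∀ (h : H) x, d₁ (h • x) = h • d₁ x)
  (hd₂ : ∀ (h : H) x, d₂ (h • x) = h • d₂ x)
  (hd₂₁ : ∀ x, d₂ (d₁ x) = 0)

omit [DistribMulAction H M₃] [SMulDistribClass H C M₃] in
include hε hinv hd₁ in
/-- For `i > 0`, an invariant cycle of `m ^ i M₂` is the boundary of an invariant modulo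
`m ^ (i + 1)`: its class in the homology of `m ^ i / m ^ (i + 1) ⊗ M / m` is invariant, while `H`
acts trivially on the homology of `M / m` and without invariants on `m ^ i / m ^ (i + 1)`. -/
lemma exists_invariant_sub_mem (hM₃ : IsSymbolFlat ε M₃)
    (hT : IsTrivialOnFiberHomology H (RingHom.ker ε) d₁ d₂) {i : ℕ} (hi : i ≠ 0) {x : M₂}
    (hx : x ∈ RingHom.ker ε ^ i • (⊤ : Submodule C M₂)) (hxH : ∀ h : H, h • x = x)
    (hdx : d₂ x = 0) :
    ∃ y ∈ RingHom.ker ε ^ i • (⊤ : Submodule C M₁), (∀ h : H, h • y = y) ∧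
      x - d₁ y ∈ RingHom.ker ε ^ (i + 1) • (⊤ : Submodule C M₂) := by
  obtain ⟨B, u, hu⟩ := exists_isSymbolBasis ε i
  obtain ⟨p, hp⟩ := hu.exists_sub_mem_smul_top x hx
  have hpb (b : B) := hT (p b) (hu.map_mem hM₃ d₂ (by simp [hdx]) p hp b)
  have hub (b : B) : average k C H (u b) = 0 :=
    hinv _ (by
      have h := average_mem k (H := H) (M := C) (smul_mem_ker_pow hε i) (x := u b)
        (by simpa using hu.mem b)
      simp only [smul_eq_mul, Ideal.mul_top] at h
      exact RingHom.mem_ker.1 (Ideal.pow_le_self hi h)) (fun h => smul_average k h (u b))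
  -- `average (u_b p_b)` is congruent to `average (u_b) p_b`, which is zero
  have h1 : average k C H (p.sum fun b y => u b • y) ∈
      RingHom.ker ε ^ i • (LinearMap.range d₁ ⊔ RingHom.ker ε • (⊤ : Submodule C M₂)) := by
    rw [Finsupp.sum, map_sum]
    refine sum_mem fun b _ => ?_
    have := average_smul_sub_mem k (smul_mem_ker_pow hε i) _ (hu.mem b) (p b) (hpb b)
    rwa [hub, zero_smul, sub_zero] at this
  have h2 := average_mem k (smul_mem_ker_pow hε (i + 1)) hp
  rw [map_sub, average_eq_self k x hxH] at h2
  rw [pow_smul_range_sup] at h1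
  obtain ⟨_, ⟨y, hy, rfl⟩, z, hz, hyz⟩ := Submodule.mem_sup.1 h1
  rw [← hyz, ← sub_sub] at h2
  have h3 : x - d₁ y ∈ RingHom.ker ε ^ (i + 1) • (⊤ : Submodule C M₂) := by
    simpa using add_mem h2 hz
  refine ⟨average k C H y, average_mem k (smul_mem_ker_pow hε i) hy, fun h => smul_average k h y,
    ?_⟩
  rw [map_average k d₁ hd₁, ← average_eq_self k (C := C) x hxH, ← map_sub]
  exact average_mem k (smul_mem_ker_pow hε (i + 1)) h3

variable {n : ℕ} (hn : RingHom.ker ε ^ n = ⊥)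

omit [DistribMulAction H M₃] [SMulDistribClass H C M₃] in
include hε hinv hd₁ hd₂₁ hn in
/-- An invariant cycle of `m M₂` is made to vanish by subtracting boundaries of invariants that move
it into higher and higher powers of the nilpotent ideal `m`. -/
lemma isInvariantExact (hM₃ : IsSymbolFlat ε M₃)
    (hT : IsTrivialOnFiberHomology H (RingHom.ker ε) d₁ d₂) :
    IsInvariantExact H (RingHom.ker ε) d₁ d₂ := by
  suffices key : ∀ j i : ℕ, i ≠ 0 → n ≤ i + j → ∀ x ∈ RingHom.ker ε ^ i • (⊤ : Submodule C M₂),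
      (∀ h : H, h • x = x) → d₂ x = 0 →
      ∃ y ∈ RingHom.ker ε • (⊤ : Submodule C M₁), (∀ h : H, h • y = y) ∧ d₁ y = x by
    intro x hx
    exact key n 1 one_ne_zero (by lia) x (by simpa using hx)
  intro j
  induction j with
  | zero =>
    intro i _ hni x hx _ _
    rw [eq_bot_iff.2 ((Ideal.pow_le_pow_right (show n ≤ i from hni)).trans hn.le),
      Submodule.bot_smul, Submodule.mem_bot] at hx
    exact ⟨0, zero_mem _, by simp, by simp [hx]⟩
  | succ j ih =>
    intro i hi hni x hx hxH hdx
    obtain ⟨y, hy, hyH, hxy⟩ := exists_invariant_sub_mem hε hinv hd₁ hM₃ hT hi hx hxH hdx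
    obtain ⟨z, hz, hzH, hdz⟩ := ih (i + 1) (by lia) (by lia) _ hxy
      (fun h => by rw [smul_sub, hxH, ← hd₁, hyH]) (by rw [map_sub, hdx, hd₂₁, sub_zero])
    exact ⟨y + z, add_mem (Submodule.smul_mono_left (Ideal.pow_le_self hi) hy) hz,
      fun h => by rw [smul_add, hyH, hzH], by rw [map_add, hdz]; abel⟩

omit [DistribMulAction H M₁] [SMulDistribClass H C M₁] in
include hε hd₂ in
/-- Modulo boundaries and `m ^ (i + 1)`, a cycle of `m ^ i M₂` is a combination of invariant cycles
with coefficients in `m ^ i`. -/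
lemma exists_sub_sub_mem (hM₃ : IsSymbolFlat ε M₃)
    (hT : IsTrivialOnFiberHomology H (RingHom.ker ε) d₁ d₂)
    {M₄ : Type*} [AddCommGroup M₄] [Module C M₄] {d₃ : M₃ →ₗ[C] M₄}
    (hd₃₂ : ∀ x, d₃ (d₂ x) = 0) (hE : IsInvariantExact H (RingHom.ker ε) d₂ d₃) {i : ℕ} {x : M₂}
    (hx : x ∈ RingHom.ker ε ^ i • (⊤ : Submodule C M₂))
    (hdx : d₂ x ∈ RingHom.ker ε ^ (i + 1) • (⊤ : Submodule C M₃)) :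
    ∃ w ∈ RingHom.ker ε ^ i • (⊤ : Submodule C M₁), ∃ z ∈ RingHom.ker ε ^ i • invariantCycles H d₂,
      x - d₁ w - z ∈ RingHom.ker ε ^ (i + 1) • (⊤ : Submodule C M₂) := by
  obtain ⟨B, u, hu⟩ := exists_isSymbolBasis ε i
  obtain ⟨p, hp⟩ := hu.exists_sub_mem_smul_top x hx
  have hpb (b : B) : p b ∈ invariantCycles H d₂ ⊔
      (LinearMap.range d₁ ⊔ RingHom.ker ε • (⊤ : Submodule C M₂)) := by
    have hdp := hu.map_mem hM₃ d₂ hdx p hp b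
    obtain ⟨r, hr, hrH, hdr⟩ := hE (average k C H (d₂ (p b)))
      (average_mem k (by simpa using smul_mem_ker_pow hε 1) hdp) (fun h => smul_average k h _)
      (by rw [← map_average k d₂ hd₂, hd₃₂])
    -- an average of `p_b` is an invariant cycle modulo `m`, and `r` corrects it to a cycle
    have hq : average k C H (p b) - r ∈ invariantCycles H d₂ :=
      Submodule.subset_span ⟨fun h => by rw [smul_sub, smul_average, hrH],
        by rw [map_sub, hdr, map_average k d₂ hd₂, sub_self]⟩
    have ha := average_sub_self_mem k _ (p b) (hT (p b) hdp)
    rw [← sub_sub_cancel (average k C H (p b) - r) (p b)]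
    refine sub_mem (Submodule.mem_sup_left hq) (Submodule.mem_sup_right ?_)
    rw [sub_right_comm]
    exact sub_mem ha (Submodule.mem_sup_right hr)
  have hs : p.sum (fun b y => u b • y) ∈ RingHom.ker ε ^ i • (invariantCycles H d₂ ⊔
      (LinearMap.range d₁ ⊔ RingHom.ker ε • (⊤ : Submodule C M₂))) :=
    sum_mem fun b _ => Submodule.smul_mem_smul (hu.mem b) (hpb b)
  rw [Submodule.smul_sup, pow_smul_range_sup] at hs
  obtain ⟨z, hz, s, hs, hzs⟩ := Submodule.mem_sup.1 hs
  obtain ⟨_, ⟨w, hw, rfl⟩, v, hv, hwv⟩ := Submodule.mem_sup.1 hs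
  refine ⟨w, hw, z, hz, ?_⟩
  rw [← hzs, ← hwv] at hp
  convert add_mem hp hv using 1
  abel

omit [DistribMulAction H M₁] [SMulDistribClass H C M₁] in
include hε hd₂ hd₂₁ hn in
/-- Every homology class is a `C`-linear combination of classes of invariant cycles, that is,
`C ⊗ M ^ H → M` is surjective on homology. -/
lemma mem_range_sup_invariantCycles (hM₃ : IsSymbolFlat ε M₃)
    (hT : IsTrivialOnFiberHomology H (RingHom.ker ε) d₁ d₂)
    {M₄ : Type*} [AddCommGroup M₄] [Module C M₄] {d₃ : M₃ →ₗ[C] M₄}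
    (hd₃₂ : ∀ x, d₃ (d₂ x) = 0) (hE : IsInvariantExact H (RingHom.ker ε) d₂ d₃) (x : M₂)
    (hdx : d₂ x = 0) :
    x ∈ LinearMap.range d₁ ⊔ invariantCycles H d₂ := by
  suffices key : ∀ j i : ℕ, n ≤ i + j → ∀ x ∈ RingHom.ker ε ^ i • (⊤ : Submodule C M₂), d₂ x = 0 →
      x ∈ LinearMap.range d₁ ⊔ invariantCycles H d₂ from key n 0 (by lia) x (by simp) hdx
  intro j
  induction j with
  | zero =>
    intro i hni x hx _
    rw [eq_bot_iff.2 ((Ideal.pow_le_pow_right (show n ≤ i from hni)).trans hn.le),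
      Submodule.bot_smul, Submodule.mem_bot] at hx
    exact hx ▸ zero_mem _
  | succ j ih =>
    intro i hni x hx hdx
    obtain ⟨w, -, z, hz, hxz⟩ :=
      exists_sub_sub_mem hε hd₂ hM₃ hT hd₃₂ hE hx (by simp [hdx])
    replace hz := Submodule.smul_le_right hz
    have := ih (i + 1) (by lia) _ hxz (by
      rw [map_sub, map_sub, hdx, hd₂₁, LinearMap.mem_ker.1 (invariantCycles_le_ker d₂ hz)]
      simp)
    have h' := add_mem (add_mem this (Submodule.mem_sup_right hz))
      (Submodule.mem_sup_left (T := invariantCycles H d₂) (LinearMap.mem_range_self d₁ w))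
    simpa using h'

omit [DistribMulAction H M₁] [SMulDistribClass H C M₁] in
include hε hd₂ hd₂₁ in
/-- The differential is strict for the filtration by powers of `m`. -/
lemma exists_mem_pow_map_eq (hM₃ : IsSymbolFlat ε M₃)
    (hT : IsTrivialOnFiberHomology H (RingHom.ker ε) d₁ d₂)
    {M₄ : Type*} [AddCommGroup M₄] [Module C M₄] {d₃ : M₃ →ₗ[C] M₄}
    (hd₃₂ : ∀ x, d₃ (d₂ x) = 0) (hE : IsInvariantExact H (RingHom.ker ε) d₂ d₃) (i : ℕ) (x : M₂)
    (hdx : d₂ x ∈ RingHom.ker ε ^ i • (⊤ : Submodule C M₃)) :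
    ∃ y ∈ RingHom.ker ε ^ i • (⊤ : Submodule C M₂), d₂ y = d₂ x := by
  induction i with
  | zero => exact ⟨x, by simp, rfl⟩
  | succ i ih =>
    obtain ⟨y, hy, hyx⟩ := ih (Submodule.smul_mono_left (Ideal.pow_le_pow_right (by lia)) hdx)
    obtain ⟨w, -, z, hz, hyz⟩ :=
      exists_sub_sub_mem hε hd₂ hM₃ hT hd₃₂ hE hy (hyx ▸ hdx)
    refine ⟨_, hyz, ?_⟩
    rw [map_sub, map_sub, hyx, hd₂₁,
      LinearMap.mem_ker.1 (invariantCycles_le_ker d₂ (Submodule.smul_le_right hz))]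
    simp

end Core

/-! ### The counit `C ⊗ M ^ H → M` -/

section Counit

variable (k : Type u) {C : Type u} (H : Type u) [Field k] [CommRing C] [Algebra k C] [Group H]
  {M N : Type*} [AddCommGroup M] [Module C M] [DistribMulAction H M]
  [AddCommGroup N] [Module C N] [DistribMulAction H N]
  [Module k M] [IsScalarTower k C M] [SMulCommClass H k M]
  [Module k N] [IsScalarTower k C N] [SMulCommClass H k N]

variable (M) in
/-- The `k`-vector space of `H`-invariants of `M`. -/
def invariants : Submodule k M where
  carrier := {x | ∀ h : H, h • x = x}
  add_mem' hx hy h := by rw [smul_add, hx h, hy h]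
  zero_mem' h := smul_zero h
  smul_mem' a x hx h := by rw [smul_comm, hx h]

/-- The map induced on invariants by an equivariant `C`-linear map. -/
def invariantsMap (f : M →ₗ[C] N) (hf : ∀ (h : H) x, f (h • x) = h • f x) :
    invariants k H M →ₗ[k] invariants k H N :=
  (f.restrictScalars k).restrict fun x hx h => by
    change h • f x = f x
    rw [← hf, hx h]

lemma invariantsMap_coe (f : M →ₗ[C] N) (hf : ∀ (h : H) x, f (h • x) = h • f x)
    (x : invariants k H M) : (invariantsMap k H f hf x : N) = f x := rfl

variable (C M) in
/-- The natural map `C ⊗ M ^ H → M`. -/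
def invariantsCounit : C ⊗[k] invariants k H M →ₗ[C] M :=
  (invariants k H M).subtype.liftBaseChange C

lemma invariantsCounit_tmul (c : C) (x : invariants k H M) :
    invariantsCounit k C H M (c ⊗ₜ x) = c • (x : M) := by
  simp [invariantsCounit]

lemma invariantsCounit_baseChange (f : M →ₗ[C] N) (hf : ∀ (h : H) x, f (h • x) = h • f x)
    (t : C ⊗[k] invariants k H M) :
    invariantsCounit k C H N ((invariantsMap k H f hf).baseChange C t) =
      f (invariantsCounit k C H M t) := by
  induction t with
  | zero => simp
  | tmul c x => simp [invariantsCounit_tmul, invariantsMap_coe]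
  | add x y hx hy => simp only [map_add, hx, hy]

/-- The invariant cycles generate a submodule of the image of the cycles of `C ⊗ M ^ H`. -/
lemma invariantCycles_le_map (f : M →ₗ[C] N) (hf : ∀ (h : H) x, f (h • x) = h • f x) :
    invariantCycles H f ≤
      (LinearMap.ker ((invariantsMap k H f hf).baseChange C)).map (invariantsCounit k C H M) :=
  Submodule.span_le.2 fun q hq => ⟨1 ⊗ₜ ⟨q, hq.1⟩, by
    have : invariantsMap k H f hf ⟨q, hq.1⟩ = 0 := Subtype.ext hq.2
    simp [this], by simp [invariantsCounit_tmul]⟩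

end Counit

section Symbols

variable {k C : Type u} [Field k] [CommRing C] [Algebra k C] {ε : C →ₐ[k] k}
  {W : Type*} [AddCommGroup W] [Module k W]

variable (ε W) in
/-- The map `c ⊗ w ↦ ε(c) w`. -/
def evalTensor : C ⊗[k] W →ₗ[k] W :=
  TensorProduct.lid k W ∘ₗ ε.toLinearMap.rTensor W

lemma evalTensor_tmul (c : C) (w : W) : evalTensor ε W (c ⊗ₜ w) = ε c • w := by
  simp [evalTensor]

lemma evalTensor_eq_zero {t : C ⊗[k] W}
    (ht : t ∈ RingHom.ker ε • (⊤ : Submodule C (C ⊗[k] W))) : evalTensor ε W t = 0 := by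
  induction ht using Submodule.smul_induction_on' with
  | smul c hc t _ =>
    induction t with
    | zero => simp
    | tmul d w =>
      rw [TensorProduct.smul_tmul', smul_eq_mul, evalTensor_tmul, map_mul, RingHom.mem_ker.1 hc,
        zero_mul, zero_smul]
    | add x y hx hy => rw [smul_add, map_add, hx trivial, hy trivial, add_zero]
  | add x _ y _ hx hy => rw [map_add, hx, hy, add_zero]

lemma sub_one_tmul_evalTensor_mem (t : C ⊗[k] W) :
    t - 1 ⊗ₜ evalTensor ε W t ∈ RingHom.ker ε • (⊤ : Submodule C (C ⊗[k] W)) := by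
  induction t with
  | zero => simp
  | tmul c w =>
    have : c ⊗ₜ[k] w - 1 ⊗ₜ evalTensor ε W (c ⊗ₜ w) =
        (c - algebraMap k C (ε c)) • ((1 : C) ⊗ₜ[k] w) := by
      rw [evalTensor_tmul, TensorProduct.smul_tmul', smul_eq_mul, mul_one, TensorProduct.sub_tmul,
        ← TensorProduct.smul_tmul, Algebra.algebraMap_eq_smul_one]
    rw [this]
    exact Submodule.smul_mem_smul (sub_algebraMap_mem_ker c) Submodule.mem_top
  | add x y hx hy =>
    rw [map_add, TensorProduct.tmul_add, add_sub_add_comm]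
    exact add_mem hx hy

/-- An element of `m ^ i ⊗ W` has an expansion `∑ u_b ⊗ w_b` modulo `m ^ (i + 1) ⊗ W`. -/
lemma IsSymbolBasis.exists_sub_sum_tmul_mem {i : ℕ} {B : Type u} {u : B → C}
    (hu : IsSymbolBasis ε i u) (t : C ⊗[k] W)
    (ht : t ∈ RingHom.ker ε ^ i • (⊤ : Submodule C (C ⊗[k] W))) :
    ∃ w : B →₀ W, t - w.sum (fun b y => u b ⊗ₜ[k] y) ∈
      RingHom.ker ε ^ (i + 1) • (⊤ : Submodule C (C ⊗[k] W)) := by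
  obtain ⟨p, hp⟩ := hu.exists_sub_mem_smul_top t ht
  refine ⟨p.mapRange (evalTensor ε W) (map_zero _), ?_⟩
  rw [Finsupp.sum_mapRange_index (by simp), ← sub_add_sub_cancel]
  refine add_mem hp ?_
  rw [Finsupp.sum, Finsupp.sum, ← Finset.sum_sub_distrib]
  refine sum_mem fun b _ => ?_
  have : u b ⊗ₜ[k] evalTensor ε W (p b) = u b • ((1 : C) ⊗ₜ[k] evalTensor ε W (p b)) := by
    rw [TensorProduct.smul_tmul', smul_eq_mul, mul_one]
  rw [this, ← smul_sub, pow_succ, Submodule.mul_smul]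
  exact Submodule.smul_mem_smul (hu.mem b) (sub_one_tmul_evalTensor_mem _)

end Symbols

section Injective

variable {k C H : Type u} [Field k] [CommRing C] [Algebra k C] [Group H] [MulSemiringAction H C]
  [Fintype H] [CharZero k] [SMulCommClass H k C] {ε : C →ₐ[k] k}
  {M₁ M₂ M₃ : Type*}
  [AddCommGroup M₁] [Module C M₁] [DistribMulAction H M₁] [SMulDistribClass H C M₁]
  [AddCommGroup M₂] [Module C M₂] [DistribMulAction H M₂] [SMulDistribClass H C M₂]
  [AddCommGroup M₃] [Module C M₃] [DistribMulAction H M₃]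
  [Module k M₁] [IsScalarTower k C M₁] [SMulCommClass H k M₁]
  [Module k M₂] [IsScalarTower k C M₂] [SMulCommClass H k M₂]
  [Module k M₃] [IsScalarTower k C M₃] [SMulCommClass H k M₃]

/-- If the differential is strict for the filtration by powers of `m`, then `C ⊗ M ^ H → M` is
injective on homology. -/
lemma exists_baseChange_eq (hε : ∀ (h : H) (c : C), ε (h • c) = ε c) {n : ℕ}
    (hn : RingHom.ker ε ^ n = ⊥) {d₁ : M₁ →ₗ[C] M₂} {d₂ : M₂ →ₗ[C] M₃}
    (hd₁ : ∀ (h : H) x, d₁ (h • x) = h • d₁ x) (hd₂ : ∀ (h : H) x, d₂ (h • x) = h • d₂ x)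
    (hd₂₁ : ∀ x, d₂ (d₁ x) = 0) (hM₂ : IsSymbolFlat ε M₂)
    (hstrict : ∀ i x, d₁ x ∈ RingHom.ker ε ^ i • (⊤ : Submodule C M₂) →
      ∃ y ∈ RingHom.ker ε ^ i • (⊤ : Submodule C M₁), d₁ y = d₁ x)
    (hE : IsInvariantExact H (RingHom.ker ε) d₁ d₂) (t : C ⊗[k] invariants k H M₂)
    (ht : (invariantsMap k H d₂ hd₂).baseChange C t = 0)
    (ht' : invariantsCounit k C H M₂ t ∈ LinearMap.range d₁) :
    t ∈ LinearMap.range ((invariantsMap k H d₁ hd₁).baseChange C) := by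
  let Z := LinearMap.ker (invariantsMap k H d₂ hd₂)
  let θ : C ⊗[k] Z →ₗ[C] C ⊗[k] invariants k H M₂ := Z.subtype.baseChange C
  have hθ (c : C) (z : Z) : θ (c ⊗ₜ z) = c ⊗ₜ (z : invariants k H M₂) := by simp [θ]
  suffices key : ∀ j i : ℕ, n ≤ i + j → ∀ t ∈ RingHom.ker ε ^ i • (⊤ : Submodule C (C ⊗[k] Z)),
      invariantsCounit k C H M₂ (θ t) ∈ LinearMap.range d₁ →
      θ t ∈ LinearMap.range ((invariantsMap k H d₁ hd₁).baseChange C) by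
    obtain ⟨t, rfl⟩ := (Module.Flat.lTensor_exact C
      (LinearMap.exact_subtype_ker_map (invariantsMap k H d₂ hd₂)) t).1 ht
    exact key n 0 (by lia) t (by simp) ht'
  intro j
  induction j with
  | zero =>
    intro i hni t ht _
    rw [eq_bot_iff.2 ((Ideal.pow_le_pow_right (show n ≤ i from hni)).trans hn.le),
      Submodule.bot_smul, Submodule.mem_bot] at ht
    rw [ht, map_zero]
    exact zero_mem _
  | succ j ih =>
    intro i hni t ht ht'
    obtain ⟨B, u, hu⟩ := exists_isSymbolBasis ε i
    obtain ⟨z, hz⟩ := hu.exists_sub_sum_tmul_mem t ht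
    obtain ⟨x, hx⟩ := ht'
    obtain ⟨y, hy, hyx⟩ := hstrict i x (by
      rw [hx]
      exact apply_mem_of_mem_smul_top _ (invariantsCounit k C H M₂ ∘ₗ θ) ht)
    obtain ⟨q, hq⟩ := hu.exists_sub_mem_smul_top y hy
    -- `∑ u_b z_b` and `∑ u_b d₁(q_b)` agree modulo `m ^ (i + 1)`, so flatness applies
    have hzq (b : B) : ((z b : invariants k H M₂) : M₂) - d₁ (q b) ∈
        RingHom.ker ε • (⊤ : Submodule C M₂) := by
      have := hM₂ hu (z.mapRange (fun z : Z => ((z : invariants k H M₂) : M₂)) (by simp) -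
        q.mapRange d₁ (map_zero _)) ?_ b
      · simpa using this
      rw [Finsupp.sum_sub_index (by simp [smul_sub]), Finsupp.sum_mapRange_index (by simp),
        Finsupp.sum_mapRange_index (by simp)]
      have h1 := apply_mem_of_mem_smul_top _ (invariantsCounit k C H M₂ ∘ₗ θ) hz
      have h2 := apply_mem_of_mem_smul_top _ d₁ hq
      rw [map_sub, hyx, hx] at h2
      have h3 := sub_mem h2 h1
      rw [map_sub, LinearMap.comp_apply, sub_sub_sub_cancel_left] at h3
      simpa [Finsupp.sum, hθ, invariantsCounit_tmul] using h3
    -- `z_b` is the boundary of an invariant: average `q_b` and apply `hE` to the difference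
    have hw (b : B) : ∃ w : invariants k H M₁, d₁ w = ((z b : invariants k H M₂) : M₂) := by
      have hzb : average k C H ((z b : invariants k H M₂) : M₂) = (z b : invariants k H M₂) :=
        average_eq_self k _ (z b : invariants k H M₂).2
      obtain ⟨r, -, hrH, hr⟩ := hE (average k C H (((z b : invariants k H M₂) : M₂) - d₁ (q b)))
        (average_mem k (by simpa using smul_mem_ker_pow hε 1) (hzq b))
        (fun h => smul_average k h _) (by
          rw [map_sub, hzb, map_sub, ← map_average k d₁ hd₁, hd₂₁, sub_zero]
          exact congr_arg Subtype.val (z b).2)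
      refine ⟨⟨average k C H (q b) + r, fun h => by rw [smul_add, smul_average, hrH]⟩, ?_⟩
      rw [map_add, hr, map_sub, hzb, map_average k d₁ hd₁]
      abel
    have hs : θ (z.sum fun b y => u b ⊗ₜ[k] y) ∈
        LinearMap.range ((invariantsMap k H d₁ hd₁).baseChange C) := by
      rw [Finsupp.sum, map_sum]
      refine sum_mem fun b _ => ?_
      obtain ⟨w, hw⟩ := hw b
      refine ⟨u b ⊗ₜ w, ?_⟩
      rw [LinearMap.baseChange_tmul, hθ]
      congr 1
      exact Subtype.ext hw
    have := ih (i + 1) (by lia) _ hz (by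
      rw [map_sub, map_sub]
      refine sub_mem ⟨x, hx⟩ ?_
      obtain ⟨s, hs⟩ := hs
      rw [← hs, invariantsCounit_baseChange]
      exact ⟨_, rfl⟩)
    rw [map_sub] at this
    simpa using add_mem this hs

end Injective

/-! ### Equivariant modules, their fibres and their invariants -/

open CategoryTheory CategoryTheory.Limits

section EquivariantModules

variable {k C H : Type u} [Field k] [CommRing C] [Algebra k C] [Group H] [MulSemiringAction H C]

instance (M : EquivariantModule C H) : DistribMulAction H M :=
  DistribMulAction.compHom M (SkewMonoidAlgebra.of C H)

lemma group_smul_eq (M : EquivariantModule C H) (h : H) (m : M) :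
    h • m = SkewMonoidAlgebra.single h (1 : C) • m := rfl

instance (M : EquivariantModule C H) : SMulDistribClass H C M where
  smul_distrib_smul h c m := by
    simp [group_smul_eq, smul_eq, smul_smul]

instance (M : EquivariantModule C H) : Module k M := Module.compHom M (algebraMap k C)

lemma field_smul_eq (M : EquivariantModule C H) (a : k) (m : M) : a • m = algebraMap k C a • m :=
  rfl

instance (M : EquivariantModule C H) : IsScalarTower k C M where
  smul_assoc a c m := by rw [Algebra.smul_def, mul_smul, field_smul_eq]

instance [SMulCommClass H k C] (M : EquivariantModule C H) : SMulCommClass H k M where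
  smul_comm h a m := by
    rw [field_smul_eq, smul_distrib_smul, smul_algebraMap, field_smul_eq]

lemma single_smul_eq (M : EquivariantModule C H) (h : H) (c : C) (m : M) :
    SkewMonoidAlgebra.single h c • m = c • h • m := by
  simp [group_smul_eq, smul_eq, smul_smul]

/-- The `C`-linear map underlying a morphism of equivariant modules. -/
def toLinearMap {M N : EquivariantModule C H} (f : M ⟶ N) : M →ₗ[C] N where
  toFun := f.hom
  map_add' := map_add f.hom
  map_smul' c m := map_smul f.hom (SkewMonoidAlgebra.single (1 : H) c) m

lemma toLinearMap_apply {M N : EquivariantModule C H} (f : M ⟶ N) (x : M) :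
    toLinearMap f x = f x := rfl

lemma toLinearMap_smul {M N : EquivariantModule C H} (f : M ⟶ N) (h : H) (x : M) :
    toLinearMap f (h • x) = h • toLinearMap f x :=
  map_smul f.hom (SkewMonoidAlgebra.single h (1 : C)) x

lemma single_one_mul (c : C) (x : SkewMonoidAlgebra C H) :
    SkewMonoidAlgebra.single (1 : H) c * x = c • x := by
  induction x using SkewMonoidAlgebra.induction_on with
  | zero => simp
  | single h d => simp [SkewMonoidAlgebra.smul_single]
  | add x y hx hy => rw [mul_add, hx, hy, smul_add]

/-- A free module over `C ⋊ H` is free over `C`. -/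
lemma projective_of_linearEquiv_finsupp (F : EquivariantModule C H) {S : Type u}
    (e : F ≃ₗ[SkewMonoidAlgebra C H] (S →₀ SkewMonoidAlgebra C H)) :
    Module.Projective C F := by
  let e' : F ≃ₗ[C] (S →₀ SkewMonoidAlgebra C H) :=
    { e.toAddEquiv with
      map_smul' c x := by
        refine (e.map_smul (SkewMonoidAlgebra.single (1 : H) c) x).trans (Finsupp.ext fun s => ?_)
        simp only [Finsupp.smul_apply]
        exact single_one_mul c (e x s) }
  exact Module.Projective.of_equiv e'.symm

/-- Projective equivariant modules are projective over `C`, because `C ⋊ H` is free over `C`. -/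
instance (M : EquivariantModule C H) [Projective M] : Module.Projective C M := by
  obtain ⟨F, ⟨e⟩⟩ : ∃ F : EquivariantModule C H, Nonempty (F ≃ₗ[SkewMonoidAlgebra C H]
      (M →₀ SkewMonoidAlgebra C H)) :=
    ⟨ModuleCat.of _ (M →₀ SkewMonoidAlgebra C H), ⟨LinearEquiv.refl _ _⟩⟩
  let p : F ⟶ M := ModuleCat.ofHom (Finsupp.linearCombination _ id ∘ₗ e.toLinearMap)
  have : Epi p := (ModuleCat.epi_iff_surjective _).2
    ((Finsupp.linearCombination_id_surjective _ M).comp e.surjective)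
  have : Module.Projective C F := projective_of_linearEquiv_finsupp F e
  refine Module.Projective.of_split (toLinearMap (Projective.factorThru (𝟙 M) p)) (toLinearMap p)
    (LinearMap.ext fun x => ?_)
  exact congr($(Projective.factorThru_comp (𝟙 M) p) x)

end EquivariantModules

section Fiber

variable {k C H : Type u} [Field k] [CommRing C] [Algebra k C] [Group H] [MulSemiringAction H C]
  (ε : C →ₐ[k] k) (M : EquivariantModule C H)

/-- The element `1` of the residue field. -/
def Residue.one : Residue ε := (1 : k)

lemma exists_one_tmul_eq (x : Residue ε ⊗[C] M) : ∃ m : M, x = Residue.one ε ⊗ₜ m := by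
  induction x with
  | zero => exact ⟨0, by simp⟩
  | tmul a m =>
    refine ⟨algebraMap k C (show k from a) • m, ?_⟩
    rw [← TensorProduct.smul_tmul, residue_smul]
    congr 1
    exact ((congr_arg (· * (1 : k)) (ε.commutes a)).trans (mul_one (show k from a))).symm
  | add x y hx hy =>
    obtain ⟨m, rfl⟩ := hx
    obtain ⟨n, rfl⟩ := hy
    exact ⟨m + n, (TensorProduct.tmul_add _ _ _).symm⟩

lemma one_tmul_smul (a : k) (m : M) :
    (Residue.one ε ⊗ₜ[C] (a • m) : Residue ε ⊗[C] M) = a • (Residue.one ε ⊗ₜ[C] m) := by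
  rw [field_smul_eq, ← TensorProduct.smul_tmul, TensorProduct.smul_tmul', residue_smul,
    AlgHom.commutes]
  rfl

lemma one_tmul_eq_zero_iff (m : M) :
    (Residue.one ε ⊗ₜ[C] m : Residue ε ⊗[C] M) = 0 ↔
      m ∈ RingHom.ker ε • (⊤ : Submodule C M) := by
  constructor
  · intro h
    let S : Submodule C M := RingHom.ker ε • ⊤
    have hS (c : C) (m : M) : S.mkQ (algebraMap k C (ε c) • m) = S.mkQ (c • m) := by
      refine (Submodule.Quotient.eq S).2 ?_
      rw [← sub_smul, ← neg_sub, neg_smul]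
      exact neg_mem (Submodule.smul_mem_smul (sub_algebraMap_mem_ker c) Submodule.mem_top)
    let f : Residue ε →ₗ[C] M →ₗ[C] M ⧸ S := LinearMap.mk₂ C
      (fun (a : Residue ε) m => S.mkQ (algebraMap k C (show k from a) • m))
      (fun a b m => by
        rw [← map_add, ← add_smul, ← map_add]; rfl)
      (fun c a m => by
        have : algebraMap k C (show k from c • a) =
          algebraMap k C (ε c) * algebraMap k C (show k from a) := (map_mul (algebraMap k C) _ _)
        rw [this, mul_smul, hS, map_smul])
      (fun a m n => by rw [smul_add, map_add])
      (fun c a m => by rw [smul_comm, map_smul])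
    have h1 : f (Residue.one ε) m = 0 := by
      rw [← TensorProduct.lift.tmul, h, map_zero]
    have h2 : f (Residue.one ε) m = S.mkQ m := by
      change S.mkQ (algebraMap k C (1 : k) • m) = _
      rw [map_one, one_smul]
    exact (Submodule.Quotient.mk_eq_zero S).1 (h2.symm.trans h1)
  · intro hm
    induction hm using Submodule.smul_induction_on' with
    | smul c hc m _ =>
      rw [← TensorProduct.smul_tmul, residue_smul, RingHom.mem_ker.1 hc, zero_smul,
        TensorProduct.zero_tmul]
    | add x _ y _ hx hy => rw [TensorProduct.tmul_add, hx, hy, add_zero]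

variable (hε : ∀ (h : H) (c : C), ε (h • c) = ε c)

/-- Triviality of the action on the homology of the fibres, expressed without tensor products. -/
lemma isTrivialOnFiberHomology {M₁ M₂ M₃ : EquivariantModule C H} (f : M₁ ⟶ M₂) (g : M₂ ⟶ M₃)
    (hfg : ∀ x : (fiber ε hε).obj M₂, (fiber ε hε).map g x = 0 →
      ∀ h : H, ∃ y : (fiber ε hε).obj M₁, (fiber ε hε).map f y =
        ((fiber ε hε).obj M₂).ρ h x - x) :
    IsTrivialOnFiberHomology H (RingHom.ker ε) (toLinearMap f) (toLinearMap g) := by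
  intro p hp h
  obtain ⟨y, hy⟩ := hfg (Residue.one ε ⊗ₜ p : Residue ε ⊗[C] M₂)
    ((one_tmul_eq_zero_iff ε M₃ _).2 hp) h
  obtain ⟨q, rfl⟩ := exists_one_tmul_eq ε M₁ y
  replace hy : Residue.one ε ⊗ₜ[C] (toLinearMap f q) =
    Residue.one ε ⊗ₜ[C] (h • p) - Residue.one ε ⊗ₜ[C] p := hy
  rw [← TensorProduct.tmul_sub, eq_comm, ← sub_eq_zero, ← TensorProduct.tmul_sub,
    one_tmul_eq_zero_iff] at hy
  rw [← sub_add_cancel (h • p - p) (toLinearMap f q)]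
  exact add_mem (Submodule.mem_sup_right hy) (Submodule.mem_sup_left ⟨q, rfl⟩)

end Fiber

section Pullback

variable {k C H : Type u} [Field k] [CommRing C] [Algebra k C] [Group H] [MulSemiringAction H C]
  [SMulCommClass H k C]

variable (k C H) in
/-- The functor of `H`-invariants, which is the pushforward along `Spec(C)/H → Spec k`. -/
def invariantsFunctor : EquivariantModule C H ⥤ ModuleCat.{u} k where
  obj M := ModuleCat.of k (invariants k H M)
  map f := ModuleCat.ofHom (invariantsMap k H (toLinearMap f) (toLinearMap_smul f))

instance : (invariantsFunctor k C H).Additive where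

lemma single_smul_tmul (W : Type u) [AddCommGroup W] [Module k W] (h : H) (c : C) (x : C) (w : W) :
    SkewMonoidAlgebra.single h c • (x ⊗ₜ[k] w) = (c * h • x) ⊗ₜ[k] w := by
  rw [TensorProduct.smul_tmul', single_smul]

lemma invariantsCounit_smul (M : EquivariantModule C H) (r : SkewMonoidAlgebra C H)
    (x : C ⊗[k] invariants k H M) :
    invariantsCounit k C H M (r • x) = r • invariantsCounit k C H M x := by
  induction r using SkewMonoidAlgebra.induction_on with
  | zero => simp
  | add r s hr hs => rw [add_smul, add_smul, map_add, hr, hs]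
  | single h c =>
    induction x with
    | zero => simp
    | tmul d w =>
      rw [single_smul_tmul, invariantsCounit_tmul, invariantsCounit_tmul, single_smul_eq,
        smul_distrib_smul h d, w.2 h, smul_smul]
    | add x y hx hy => rw [smul_add, map_add, map_add, smul_add, hx, hy]

/-- The counit `C ⊗ M ^ H → M` of the adjunction between pullback and invariants. -/
def counit : invariantsFunctor k C H ⋙ pullback k C H ⟶ 𝟭 _ where
  app M := ModuleCat.ofHom (Y := M)
    { toFun := invariantsCounit k C H M
      map_add' := map_add _
      map_smul' := invariantsCounit_smul M }
  naturality M N f := by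
    ext x
    exact invariantsCounit_baseChange k H (toLinearMap f) (toLinearMap_smul f) x

lemma single_one_smul_tensor (W : Type u) [AddCommGroup W] [Module k W] (c : C) (x : C ⊗[k] W) :
    SkewMonoidAlgebra.single (1 : H) c • x = c • x := by
  induction x with
  | zero => rw [smul_zero, smul_zero]
  | tmul d w => rw [single_smul_tmul, one_smul, TensorProduct.smul_tmul', smul_eq_mul]
  | add x y hx hy => rw [smul_add, smul_add, hx, hy]

/-- The `C`-module underlying the equivariant module `C ⊗ W` is the usual one. -/
def pullbackEquiv (W : ModuleCat.{u} k) : (pullback k C H).obj W ≃ₗ[C] C ⊗[k] W :=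
  { AddEquiv.refl (C ⊗[k] W) with
    map_smul' c x := single_one_smul_tensor W c x }

variable (C H) in
/-- The unit `W → (C ⊗ W) ^ H`. -/
def invariantsUnit (W : ModuleCat.{u} k) : W →ₗ[k] invariants k H ((pullback k C H).obj W) where
  toFun w := ⟨(pullbackEquiv W).symm (1 ⊗ₜ w), fun h =>
    (single_smul_tmul W h (1 : C) (1 : C) w).trans (by rw [smul_one, one_mul]; rfl)⟩
  map_add' x y := Subtype.ext (TensorProduct.tmul_add _ _ _)
  map_smul' a x := Subtype.ext (by
    change (pullbackEquiv (H := H) W).symm ((1 : C) ⊗ₜ[k] (a • x)) =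
      algebraMap k C a • (pullbackEquiv (H := H) W).symm ((1 : C) ⊗ₜ[k] x)
    rw [← map_smul, TensorProduct.smul_tmul', smul_eq_mul, mul_one,
      Algebra.algebraMap_eq_smul_one, TensorProduct.smul_tmul])

lemma invariantsUnit_coe (W : ModuleCat.{u} k) (w : W) :
    (invariantsUnit C H W w : (pullback k C H).obj W) = (pullbackEquiv W).symm (1 ⊗ₜ w) := rfl

lemma invariantsCounit_lTensor_unit (W : ModuleCat.{u} k) (x : C ⊗[k] W) :
    invariantsCounit k C H ((pullback k C H).obj W) ((invariantsUnit C H W).lTensor C x) =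
      (pullbackEquiv W).symm x := by
  induction x with
  | zero => simp
  | tmul c w =>
    rw [LinearMap.lTensor_tmul, invariantsCounit_tmul, invariantsUnit_coe, ← map_smul,
      TensorProduct.smul_tmul', smul_eq_mul, mul_one]
  | add x y hx hy => rw [map_add, map_add, map_add, hx, hy]

variable (k C H) in
/-- Pullback is left adjoint to invariants. -/
def pullbackAdjunction : pullback k C H ⊣ invariantsFunctor k C H where
  unit := { app W := ModuleCat.ofHom (invariantsUnit C H W) }
  counit := counit
  left_triangle_components W := by
    ext x
    exact invariantsCounit_lTensor_unit W x
  right_triangle_components M := by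
    ext x
    exact Subtype.ext ((invariantsCounit_tmul k H (1 : C) (x : invariants k H M)).trans
      (one_smul C (x : invariants k H M).1))

section

variable (ε : C →ₐ[k] k) (hε : ∀ (h : H) (c : C), ε (h • c) = ε c)

/-- The map from `W`, with the trivial action, to the fibre of `C ⊗ W`. -/
def toFiberPullback : Rep.trivialFunctor k H ⟶ pullback k C H ⋙ fiber ε hε where
  app W := Rep.ofHom
    { toFun w := Residue.one ε ⊗ₜ[C] (invariantsUnit C H W w : (pullback k C H).obj W)
      map_add' x y := by
        rw [← TensorProduct.tmul_add, map_add]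
        rfl
      map_smul' a w := by
        rw [map_smul]
        exact one_tmul_smul ε _ a _
      isIntertwining' h := LinearMap.ext fun w =>
        congr_arg (Residue.one ε ⊗ₜ[C] ·) ((invariantsUnit C H W w).2 h).symm }
  naturality W W' f := by
    ext w
    rfl

instance (W : ModuleCat.{u} k) : IsIso ((toFiberPullback (H := H) ε hε).app W) := by
  have h1 : Mono ((toFiberPullback (H := H) ε hε).app W) := by
    rw [Rep.mono_iff_injective]
    refine (injective_iff_map_eq_zero _).2 fun w hw => ?_
    have h := apply_mem_of_mem_smul_top _ (pullbackEquiv W).toLinearMap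
      ((one_tmul_eq_zero_iff ε ((pullback k C H).obj W) _).1 hw)
    have h' := evalTensor_eq_zero h
    rwa [invariantsUnit_coe, LinearEquiv.coe_coe, LinearEquiv.apply_symm_apply, evalTensor_tmul,
      map_one, one_smul] at h'
  have h2 : Epi ((toFiberPullback (H := H) ε hε).app W) := by
    rw [Rep.epi_iff_surjective]
    intro x
    obtain ⟨m, rfl⟩ := exists_one_tmul_eq ε _ x
    refine ⟨evalTensor ε W (pullbackEquiv W m), ?_⟩
    refine sub_eq_zero.1 (.trans (TensorProduct.tmul_sub _ _ _).symm
      ((one_tmul_eq_zero_iff ε ((pullback k C H).obj W) _).2 ?_))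
    have h := apply_mem_of_mem_smul_top _ (pullbackEquiv (H := H) W).symm.toLinearMap
      (sub_one_tmul_evalTensor_mem (ε := ε) (pullbackEquiv W m))
    rw [← neg_mem_iff, neg_sub, invariantsUnit_coe]
    simpa using h
  exact isIso_of_mono_of_epi _

/-- The fibre of `C ⊗ W` is `W` with the trivial action of `H`. -/
def pullbackFiberIso : Rep.trivialFunctor k H ≅ pullback k C H ⋙ fiber ε hε :=
  NatIso.ofComponents (fun W => asIso ((toFiberPullback ε hε).app W))
    (fun f => (toFiberPullback ε hε).naturality f)

end

end Pullback

/-! ### K-projective complexes and homology of complexes of modules -/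

section LeftDerived

variable {R : Type u} [Ring R]

/-- A K-projective complex is initial among the complexes quasi-isomorphic to it. -/
def isInitialOfIsKProjective (P : CochainComplex (ModuleCat.{u} R) ℤ) [P.IsKProjective] :
    IsInitial (StructuredArrow.mk (T := DerivedCategory.Qh)
      (𝟙 (DerivedCategory.Qh.obj ((HomotopyCategory.quotient _ _).obj P)))) :=
  have h (L) := CochainComplex.IsKProjective.Qh_map_bijective P L
  IsInitial.ofUniqueHom
    (fun Y => StructuredArrow.homMk ((h Y.right).2 Y.hom).choose (by
      have := ((h Y.right).2 Y.hom).choose_spec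
      dsimp
      rw [this, Category.id_comp]))
    (fun Y m => by
      ext
      apply (h Y.right).1
      have h1 := StructuredArrow.w m
      have h2 := ((h Y.right).2 Y.hom).choose_spec
      dsimp at h1 ⊢
      rw [Category.id_comp] at h1
      exact h1.trans h2.symm)

variable {A : Type*} [Category A] [Abelian A] [HasDerivedCategory A]
  (F : ModuleCat.{u} R ⥤ A) [F.Additive]

/-- The left derived functor of `F` is computed by applying `F` to K-projective complexes. -/
lemma isIso_totalLeftDerivedCounit_app (P : CochainComplex (ModuleCat.{u} R) ℤ)
    [P.IsKProjective] :
    IsIso (((F.mapHomotopyCategory (ComplexShape.up ℤ) ⋙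
      DerivedCategory.Qh).totalLeftDerivedCounit DerivedCategory.Qh
        (HomotopyCategory.quasiIso (ModuleCat.{u} R) (ComplexShape.up ℤ))).app
          ((HomotopyCategory.quotient _ _).obj P)) := by
  have h := IsLimit.isIso_π_app_of_isInitial
    (Functor.isPointwiseRightKanExtensionOfHasPointwiseLeftDerivedFunctor _
      ((F.mapHomotopyCategory (ComplexShape.up ℤ) ⋙
        DerivedCategory.Qh).totalLeftDerivedCounit DerivedCategory.Qh
          (HomotopyCategory.quasiIso (ModuleCat.{u} R) (ComplexShape.up ℤ)))
      (HomotopyCategory.quasiIso (ModuleCat.{u} R) (ComplexShape.up ℤ)) _) _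
    (isInitialOfIsKProjective P)
  change IsIso ((leftDerived F).map (𝟙 _) ≫ (Functor.totalLeftDerivedCounit _ _ _).app _) at h
  rw [CategoryTheory.Functor.map_id] at h
  exact (congr_arg (fun f => IsIso f) (Category.id_comp _)).mp h

/-- The value of the left derived functor of `F` on a K-projective complex `P` is `F(P)`. -/
def leftDerivedObjIso (P : CochainComplex (ModuleCat.{u} R) ℤ) [P.IsKProjective] :
    (leftDerived F).obj (DerivedCategory.Q.obj P) ≅
      DerivedCategory.Q.obj ((F.mapHomologicalComplex _).obj P) :=
  (leftDerived F).mapIso ((DerivedCategory.quotientCompQhIso _).symm.app P) ≪≫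
    @asIso _ _ _ _ _ (isIso_totalLeftDerivedCounit_app F P) ≪≫
    DerivedCategory.Qh.mapIso ((F.mapHomotopyCategoryFactors _).app P) ≪≫
    (DerivedCategory.quotientCompQhIso _).app _

end LeftDerived

section Adjunction

variable {A B : Type*} [Category A] [Category B] [Abelian A] [Abelian B]
  {F : A ⥤ B} {G : B ⥤ A} [F.Additive] [G.Additive]

/-- A left adjoint preserves K-projective complexes if its right adjoint preserves acyclic
complexes. -/
lemma isKProjective_of_adjunction (adj : F ⊣ G)
    (hG : ∀ L : CochainComplex B ℤ, L.Acyclic → HomologicalComplex.Acyclic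
      ((G.mapHomologicalComplex (ComplexShape.up ℤ)).obj L))
    (P : CochainComplex A ℤ) [P.IsKProjective] :
    CochainComplex.IsKProjective ((F.mapHomologicalComplex (ComplexShape.up ℤ)).obj P) where
  nonempty_homotopy_zero {L} f hL := by
    let g : P ⟶ (G.mapHomologicalComplex (ComplexShape.up ℤ)).obj L :=
      (NatTrans.mapHomologicalComplex adj.unit (ComplexShape.up ℤ)).app P ≫
        (G.mapHomologicalComplex (ComplexShape.up ℤ)).map f
    let e : (F.mapHomologicalComplex (ComplexShape.up ℤ)).obj
        ((G.mapHomologicalComplex (ComplexShape.up ℤ)).obj L) ⟶ L :=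
      (NatTrans.mapHomologicalComplex adj.counit (ComplexShape.up ℤ)).app L
    have hf : f = (F.mapHomologicalComplex (ComplexShape.up ℤ)).map g ≫ e := by
      ext i
      change f.f i = F.map (adj.unit.app (P.X i) ≫ G.map (f.f i)) ≫ adj.counit.app (L.X i)
      rw [F.map_comp, Category.assoc]
      exact ((adj.left_triangle_components_assoc _ _).symm.trans
        (congr_arg (F.map (adj.unit.app (P.X i)) ≫ ·) (adj.counit.naturality (f.f i)).symm))
    obtain ⟨h⟩ := CochainComplex.IsKProjective.nonempty_homotopy_zero g (hG L hL)
    exact ⟨(Homotopy.ofEq hf).trans (((F.mapHomotopy h).compRight e).trans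
      (Homotopy.ofEq (by simp)))⟩

end Adjunction

section Concrete

variable {R : Type u} [Ring R] (K L : CochainComplex (ModuleCat.{u} R) ℤ)

lemma exists_iCycles_eq {i j : ℤ} (hij : i + 1 = j) (x : K.X i) (hx : K.d i j x = 0) :
    ∃ c : K.cycles i, K.iCycles i c = x :=
  (ShortComplex.moduleCat_exact_iff _).1 (ShortComplex.exact_of_f_is_kernel
    (.mk (K.iCycles i) (K.d i j) (K.iCycles_d i j)) (K.cyclesIsKernel i j (by simp [← hij]))) x hx

lemma exists_d_eq_iCycles {i j : ℤ} (hij : i + 1 = j) (c : K.cycles j)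
    (hc : K.homologyπ j c = 0) : ∃ y : K.X i, K.d i j y = K.iCycles j c := by
  obtain ⟨y, rfl⟩ := (ShortComplex.moduleCat_exact_iff _).1 (ShortComplex.exact_of_g_is_cokernel
    (.mk (K.toCycles i j) (K.homologyπ j) (K.toCycles_comp_homologyπ i j))
    (K.homologyIsCokernel i j (by simp [← hij]))) c hc
  exact ⟨y, by rw [← ModuleCat.comp_apply, K.toCycles_i]⟩

variable {K L}

/-- A criterion for a map of complexes of modules to be a quasi-isomorphism, in terms of cycles and
boundaries. -/
lemma quasiIso_of_elements (φ : K ⟶ L)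
    (hinj : ∀ i j l : ℤ, i + 1 = j → j + 1 = l → ∀ (x : K.X j) (y : L.X i), K.d j l x = 0 →
      L.d i j y = φ.f j x → ∃ z : K.X i, K.d i j z = x)
    (hsurj : ∀ i j l : ℤ, i + 1 = j → j + 1 = l → ∀ y : L.X j, L.d j l y = 0 →
      ∃ (x : K.X j) (z : L.X i), K.d j l x = 0 ∧ y = φ.f j x + L.d i j z) : QuasiIso φ := by
  rw [quasiIso_iff]
  intro n
  rw [quasiIsoAt_iff_isIso_homologyMap]
  have hm : Mono (HomologicalComplex.homologyMap φ n) := by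
    rw [ModuleCat.mono_iff_injective, injective_iff_map_eq_zero]
    intro a ha
    obtain ⟨c, rfl⟩ := (ModuleCat.epi_iff_surjective (K.homologyπ n)).1 inferInstance a
    rw [← ModuleCat.comp_apply, HomologicalComplex.homologyπ_naturality, ModuleCat.comp_apply] at ha
    obtain ⟨y, hy⟩ := exists_d_eq_iCycles L (i := n - 1) (by lia) _ ha
    rw [← ModuleCat.comp_apply, HomologicalComplex.cyclesMap_i, ModuleCat.comp_apply] at hy
    obtain ⟨z, hz⟩ := hinj (n - 1) n (n + 1) (by lia) rfl (K.iCycles n c) y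
      (by rw [← ModuleCat.comp_apply, K.iCycles_d]; rfl) hy
    have : K.toCycles (n - 1) n z = c := by
      apply (ModuleCat.mono_iff_injective (K.iCycles n)).1 inferInstance
      rw [← ModuleCat.comp_apply, K.toCycles_i, hz]
    rw [← this, ← ModuleCat.comp_apply, K.toCycles_comp_homologyπ]
    rfl
  have he : Epi (HomologicalComplex.homologyMap φ n) := by
    rw [ModuleCat.epi_iff_surjective]
    intro a
    obtain ⟨c, rfl⟩ := (ModuleCat.epi_iff_surjective (L.homologyπ n)).1 inferInstance a
    obtain ⟨x, z, hx, hxz⟩ := hsurj (n - 1) n (n + 1) (by lia) rfl (L.iCycles n c)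
      (by rw [← ModuleCat.comp_apply, L.iCycles_d]; rfl)
    obtain ⟨b, rfl⟩ := exists_iCycles_eq K rfl x hx
    have : c = HomologicalComplex.cyclesMap φ n b + L.toCycles (n - 1) n z := by
      apply (ModuleCat.mono_iff_injective (L.iCycles n)).1 inferInstance
      rw [map_add, ← ModuleCat.comp_apply, ← ModuleCat.comp_apply, HomologicalComplex.cyclesMap_i,
        L.toCycles_i, ModuleCat.comp_apply, hxz]
    refine ⟨K.homologyπ n b, ?_⟩
    rw [this, map_add, ← ModuleCat.comp_apply, ← ModuleCat.comp_apply, ← ModuleCat.comp_apply,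
      HomologicalComplex.homologyπ_naturality, L.toCycles_comp_homologyπ]
    simp
  exact isIso_of_mono_of_epi _

lemma acyclic_iff_elements : HomologicalComplex.Acyclic K ↔
    ∀ i j l : ℤ, i + 1 = j → j + 1 = l → ∀ x : K.X j, K.d j l x = 0 →
      ∃ y : K.X i, K.d i j y = x := by
  have (i j l : ℤ) (hij : i + 1 = j) (hjl : j + 1 = l) :
      K.ExactAt j ↔ ∀ x : K.X j, K.d j l x = 0 → ∃ y : K.X i, K.d i j y = x := by
    rw [K.exactAt_iff' i j l (by simp [← hij]) (by simp [← hjl]), ShortComplex.moduleCat_exact_iff]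
    rfl
  refine ⟨fun h i j l hij hjl => (this i j l hij hjl).1 (h j), fun h j => ?_⟩
  exact (this (j - 1) j (j + 1) (by lia) rfl).2 (h _ _ _ (by lia) rfl)

/-- A surjection of acyclic complexes has the right lifting property against the generating
cofibrations. -/
lemma rlp_of_acyclic (p : K ⟶ L) (hK : HomologicalComplex.Acyclic K)
    (hL : HomologicalComplex.Acyclic L) (hp : ∀ n, Function.Surjective (p.f n)) :
    (cells R).rlp p := by
  rw [acyclic_iff_elements] at hK hL
  apply rlp_of_exists
  intro n y z hz hyz
  obtain ⟨x, rfl⟩ := hK n (n + 1) (n + 2) rfl (by ring) z hz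
  obtain ⟨w, hw⟩ := hL (n - 1) n (n + 1) (by lia) rfl (p.f n x - y) (by
    rw [map_sub, ← hyz, sub_eq_zero, ← ModuleCat.comp_apply, ← ModuleCat.comp_apply, p.comm])
  obtain ⟨w, rfl⟩ := hp _ w
  refine ⟨x - K.d (n - 1) n w, ?_, ?_⟩
  · rw [map_sub, ← ModuleCat.comp_apply, K.d_comp_d]
    simp
  · rw [map_sub, ← ModuleCat.comp_apply, ← p.comm, ModuleCat.comp_apply, hw, sub_sub_cancel]

end Concrete

/-! ### Resolutions with projective terms -/

open scoped ZeroObject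

section TermwiseProjective

variable {R : Type u} [Ring R]

/-- The differential `(a, b) ↦ (0, a)` of `pathComplex`. -/
def pathComplexD (N : ℤ → ModuleCat.{u} R) (i : ℤ) :
    ModuleCat.of R (N (i + 1) × N i) ⟶ ModuleCat.of R (N (i + 1 + 1) × N (i + 1)) :=
  ModuleCat.ofHom (LinearMap.inr R (N (i + 1 + 1)) (N (i + 1)) ∘ₗ LinearMap.fst R (N (i + 1)) (N i))

/-- The contractible complex with terms `N (i + 1) × N i` and differential `(a, b) ↦ (0, a)`. -/
def pathComplex (N : ℤ → ModuleCat.{u} R) : CochainComplex (ModuleCat.{u} R) ℤ :=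
  CochainComplex.of (fun i => ModuleCat.of R (N (i + 1) × N i)) (pathComplexD N)
    (fun i => by ext x <;> rfl)

lemma pathComplex_d (N : ℤ → ModuleCat.{u} R) (i : ℤ) (x : N (i + 1) × N i) :
    (pathComplex N).d i (i + 1) x = ((0, x.1) : N (i + 1 + 1) × N (i + 1)) :=
  congr($(CochainComplex.of_d _ (pathComplexD N) i) x)

lemma acyclic_pathComplex (N : ℤ → ModuleCat.{u} R) :
    HomologicalComplex.Acyclic (pathComplex N) := by
  rw [acyclic_iff_elements]
  rintro i _ _ rfl rfl ⟨a, b⟩ hx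
  obtain rfl : a = 0 := congr_arg Prod.snd ((pathComplex_d N (i + 1) (a, b)).symm.trans hx)
  exact ⟨(b, 0), pathComplex_d N i (b, 0)⟩

/-- The map of path complexes induced by a family of linear maps. -/
def pathMap {M N : ℤ → ModuleCat.{u} R} (φ : ∀ i, M i ⟶ N i) : pathComplex M ⟶ pathComplex N where
  f i := ModuleCat.ofHom (X := M (i + 1) × M i) (Y := N (i + 1) × N i)
    ((φ (i + 1)).hom.prodMap (φ i).hom)
  comm' := by
    rintro i _ rfl
    ext x
    refine (pathComplex_d N i (φ (i + 1) x.1, φ i x.2)).trans ?_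
    refine .trans ?_ (congr_arg ((φ (i + 1 + 1)).hom.prodMap (φ (i + 1)).hom)
      (pathComplex_d M i x)).symm
    exact Prod.ext (map_zero (φ (i + 1 + 1)).hom).symm rfl

/-- The map `x ↦ (d x, x)` from a complex to the path complex on its terms. -/
def toPathComplex (P : CochainComplex (ModuleCat.{u} R) ℤ) : P ⟶ pathComplex P.X where
  f i := ModuleCat.ofHom (Y := P.X (i + 1) × P.X i) ((P.d i (i + 1)).hom.prod LinearMap.id)
  comm' := by
    rintro i _ rfl
    ext x
    refine (pathComplex_d P.X i (P.d i (i + 1) x, x)).trans ?_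
    refine Prod.ext ?_ rfl
    change 0 = (P.d i (i + 1) ≫ P.d (i + 1) (i + 1 + 1)) x
    rw [P.d_comp_d]
    rfl

/-- A complex with the left lifting property against the maps `p` such that `(cells R).rlp p` has
projective terms: the identity of its terms lifts along a cover by free modules, since that cover
induces a surjection of path complexes. -/
lemma projective_X_of_llp (P : CochainComplex (ModuleCat.{u} R) ℤ)
    (hP : (cells R).rlp.llp (0 : 0 ⟶ P)) (n : ℤ) : Projective (P.X n) := by
  let φ (i : ℤ) : ModuleCat.of R (P.X i →₀ R) ⟶ P.X i :=
    ModuleCat.ofHom (Finsupp.linearCombination R id)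
  have hφ (i : ℤ) : Function.Surjective (φ i) := Finsupp.linearCombination_id_surjective R _
  have := hP _ (rlp_of_acyclic (pathMap φ) (acyclic_pathComplex _) (acyclic_pathComplex _)
    fun i => (hφ (i + 1)).prodMap (hφ i))
  have sq : CommSq (0 : 0 ⟶ pathComplex _) (0 : 0 ⟶ P) (pathMap φ) (toPathComplex P) := ⟨by simp⟩
  let s : P.X n →ₗ[R] (P.X n →₀ R) := LinearMap.snd R _ _ ∘ₗ (sq.lift.f n).hom
  have hs (x : P.X n) : φ n (s x) = x :=
    congr_arg Prod.snd congr(($(sq.fac_right)).f n x)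
  rw [← IsProjective.iff_projective]
  exact Module.Projective.of_split s (φ n).hom (LinearMap.ext hs)

/-- Every complex has a K-projective resolution with projective terms. -/
lemma exists_kProjective_resolution_projective (X : CochainComplex (ModuleCat.{u} R) ℤ) :
    ∃ (P : CochainComplex (ModuleCat.{u} R) ℤ) (p : P ⟶ X), P.IsKProjective ∧
      (∀ n, Projective (P.X n)) ∧ QuasiIso p := by
  let h := MorphismProperty.factorizationData (cells R).rlp.llp (cells R).rlp (0 : 0 ⟶ X)
  have hZ : (cells R).rlp.llp (0 : 0 ⟶ h.Z) := by
    rw [← (isZero_zero _).eq_of_src h.i 0]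
    exact h.hi
  exact ⟨h.Z, h.p, isKProjective_of_llp _ hZ, projective_X_of_llp _ hZ, quasiIso_of_rlp _ h.hp⟩

end TermwiseProjective

/-! ### Complexes of representations with trivial homology -/

section TrivialHomology

variable {k H : Type u} [Field k] [Group H]

/-- `H` acts trivially on the representation `A`. -/
def HasTrivialAction (A : Rep.{u} k H) : Prop := ∀ (h : H) (x : A), A.ρ h x = x

lemma hom_ρ {A B : Rep.{u} k H} (f : A ⟶ B) (h : H) (x : A) :
    f.hom (A.ρ h x) = B.ρ h (f.hom x) :=
  congr($(f.hom.isIntertwining' h) x)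

lemma HasTrivialAction.of_mono {A B : Rep.{u} k H} (hB : HasTrivialAction B) (f : A ⟶ B) [Mono f] :
    HasTrivialAction A := fun h x => (Rep.mono_iff_injective f).1 inferInstance (by
  rw [hom_ρ, hB])

lemma HasTrivialAction.of_epi {A B : Rep.{u} k H} (hA : HasTrivialAction A) (f : A ⟶ B) [Epi f] :
    HasTrivialAction B := fun h x => by
  obtain ⟨x, rfl⟩ := (Rep.epi_iff_surjective f).1 inferInstance x
  rw [← hom_ρ, hA]

lemma rep_exact {S : ShortComplex (Rep.{u} k H)} (hS : S.Exact) (x : S.X₂) (hx : S.g.hom x = 0) :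
    ∃ y : S.X₁, S.f.hom y = x :=
  (ShortComplex.moduleCat_exact_iff _).1
    ((S.exact_map_iff_of_faithful (forget₂ (Rep.{u} k H) (ModuleCat.{u} k))).2 hS) x hx

/-- The homology of a complex of trivial representations is trivial. -/
lemma HasTrivialAction.homology (E : CochainComplex (Rep.{u} k H) ℤ)
    (hE : ∀ n, HasTrivialAction (E.X n)) (n : ℤ) : HasTrivialAction (E.homology n) :=
  ((hE n).of_mono (E.iCycles n)).of_epi (E.homologyπ n)

lemma hasTrivialAction_homology_of_isTrivialAction (E : CochainComplex (Rep.{u} k H) ℤ)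
    (hE : IsTrivialAction (DerivedCategory.Q.obj E)) (n : ℤ) : HasTrivialAction (E.homology n) := by
  obtain ⟨W, ⟨e⟩⟩ := hE
  let W' := DerivedCategory.Q.objPreimage W
  let E' := ((Rep.trivialFunctor.{u} k H).mapHomologicalComplex (ComplexShape.up ℤ)).obj W'
  let e' : DerivedCategory.Q.obj E' ≅ DerivedCategory.Q.obj E :=
    (Rep.trivialFunctor.{u} k H).mapDerivedCategoryFactors.symm.app W' ≪≫
      (Rep.trivialFunctor.{u} k H).mapDerivedCategory.mapIso
        (DerivedCategory.Q.objObjPreimageIso W) ≪≫ e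
  let e'' : E'.homology n ≅ E.homology n :=
    (DerivedCategory.homologyFunctorFactors _ n).symm.app E' ≪≫
      (DerivedCategory.homologyFunctor _ n).mapIso e' ≪≫
        (DerivedCategory.homologyFunctorFactors _ n).app E
  have : HasTrivialAction (E'.homology n) := HasTrivialAction.homology E' (fun _ _ _ => rfl) n
  exact this.of_epi e''.hom

/-- If `H` acts trivially on the homology, then `h x - x` is a boundary for each cycle `x`. -/
lemma exists_d_eq_ρ_sub (E : CochainComplex (Rep.{u} k H) ℤ)
    {i j l : ℤ} (hij : i + 1 = j) (hjl : j + 1 = l) (hE : HasTrivialAction (E.homology j))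
    (x : E.X j) (hx : (E.d j l).hom x = 0) (h : H) :
    ∃ y : E.X i, (E.d i j).hom y = (E.X j).ρ h x - x := by
  obtain ⟨c, rfl⟩ := rep_exact (ShortComplex.exact_of_f_is_kernel
    (.mk (E.iCycles j) (E.d j l) (E.iCycles_d j l)) (E.cyclesIsKernel j l (by simp [← hjl]))) x hx
  obtain ⟨y, hy⟩ := rep_exact (ShortComplex.exact_of_g_is_cokernel
    (.mk (E.toCycles i j) (E.homologyπ j) (E.toCycles_comp_homologyπ i j))
    (E.homologyIsCokernel i j (by simp [← hij]))) ((E.cycles j).ρ h c - c)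
    (by
      change (E.homologyπ j).hom _ = 0
      rw [map_sub, hom_ρ, hE, sub_self])
  refine ⟨y, ?_⟩
  change (E.d i j).hom y = (E.X j).ρ h ((E.iCycles j).hom c) - (E.iCycles j).hom c
  rw [← hom_ρ, ← map_sub]
  exact (congr(($(E.toCycles_i i j)).hom y)).symm.trans (congr_arg (E.iCycles j).hom hy)

end TrivialHomology

/-! ### Descent -/

section Descent

variable {k C H : Type u} [Field k] [CharZero k] [CommRing C] [Algebra k C] [Group H] [Fintype H]
  [MulSemiringAction H C] [SMulCommClass H k C]

/-- The invariants of an acyclic complex of equivariant modules are acyclic. -/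
lemma acyclic_invariants (L : CochainComplex (EquivariantModule C H) ℤ)
    (hL : HomologicalComplex.Acyclic L) : HomologicalComplex.Acyclic
      (((invariantsFunctor k C H).mapHomologicalComplex (ComplexShape.up ℤ)).obj L) := by
  rw [acyclic_iff_elements] at hL ⊢
  intro i j l hij hjl x hx
  obtain ⟨y, hy⟩ := hL i j l hij hjl (x : invariants k H (L.X j)).1 (congr_arg Subtype.val hx)
  refine ⟨(⟨average k C H y, fun h => smul_average k h y⟩ : invariants k H (L.X i)),
    Subtype.ext ?_⟩
  refine (map_average k (toLinearMap (L.d i j)) (toLinearMap_smul _) y).trans ?_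
  rw [toLinearMap_apply, hy]
  exact average_eq_self k _ (x : invariants k H (L.X j)).2

variable (ε : C →ₐ[k] k) (hε : ∀ (h : H) (c : C), ε (h • c) = ε c)

/-- The derived fibre of the pullback of a complex of vector spaces is that complex with the trivial
action. -/
lemma essImage_trivialFunctor_leftDerived_fiber
    {F : DerivedCategory (EquivariantModule C H)}
    (hF : (pullback k C H).mapDerivedCategory.essImage F) :
    (Rep.trivialFunctor.{u} k H).mapDerivedCategory.essImage
      ((leftDerived (fiber ε hε)).obj F) := by
  obtain ⟨W, ⟨e⟩⟩ := hF
  obtain ⟨P, p, hP, hp⟩ := exists_kProjective_resolution (DerivedCategory.Q.objPreimage W)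
  let eW : DerivedCategory.Q.obj P ≅ W :=
    asIso (DerivedCategory.Q.map p) ≪≫ DerivedCategory.Q.objObjPreimageIso W
  have := isKProjective_of_adjunction (pullbackAdjunction k C H) acyclic_invariants P
  exact ⟨DerivedCategory.Q.obj P, ⟨(Rep.trivialFunctor.{u} k H).mapDerivedCategoryFactors.app P ≪≫
    DerivedCategory.Q.mapIso ((NatIso.mapHomologicalComplex (pullbackFiberIso ε hε) _).app P) ≪≫
    (leftDerivedObjIso (fiber ε hε)
      (((pullback k C H).mapHomologicalComplex (ComplexShape.up ℤ)).obj P)).symm ≪≫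
    (leftDerived (fiber ε hε)).mapIso ((pullback k C H).mapDerivedCategoryFactors.symm.app P ≪≫
      (pullback k C H).mapDerivedCategory.mapIso eW ≪≫ e)⟩⟩

variable (k) in
/-- The counit `C ⊗ P ^ H → P` for a complex `P` of equivariant modules. -/
def counitComplex (P : CochainComplex (EquivariantModule C H) ℤ) :
    ((pullback k C H).mapHomologicalComplex (ComplexShape.up ℤ)).obj
      (((invariantsFunctor k C H).mapHomologicalComplex (ComplexShape.up ℤ)).obj P) ⟶ P :=
  (NatTrans.mapHomologicalComplex counit (ComplexShape.up ℤ)).app P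

variable {ε hε}
  (hinv : ∀ c : C, ε c = 0 → (∀ h : H, h • c = c) → c = 0) {n : ℕ} (hn : RingHom.ker ε ^ n = ⊥)

include hinv hn in
/-- For a complex `P` of projective modules such that `H` acts trivially on the homology of its
fibre, `C ⊗ P ^ H → P` is a quasi-isomorphism. -/
lemma quasiIso_counit (P : CochainComplex (EquivariantModule C H) ℤ)
    (hP : ∀ j, Projective (P.X j))
    (hT : ∀ j, HasTrivialAction
      ((((fiber ε hε).mapHomologicalComplex (ComplexShape.up ℤ)).obj P).homology j)) :
    QuasiIso (counitComplex k P) := by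
  have hM (j : ℤ) : IsSymbolFlat ε (P.X j) := isSymbolFlat_of_projective
  have hd (i j l : ℤ) (x : P.X i) :
      toLinearMap (P.d j l) (toLinearMap (P.d i j) x) = 0 := congr($(P.d_comp_d i j l) x)
  have hT' (i j l : ℤ) (hij : i + 1 = j) (hjl : j + 1 = l) : IsTrivialOnFiberHomology H
      (RingHom.ker ε) (toLinearMap (P.d i j)) (toLinearMap (P.d j l)) :=
    isTrivialOnFiberHomology ε hε _ _ fun x hx h => exists_d_eq_ρ_sub _ hij hjl (hT j) x hx h
  have hE (i j l : ℤ) (hij : i + 1 = j) (hjl : j + 1 = l) : IsInvariantExact H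
      (RingHom.ker ε) (toLinearMap (P.d i j)) (toLinearMap (P.d j l)) :=
    isInvariantExact hε hinv (toLinearMap_smul _) (hd i j l) hn (hM l) (hT' i j l hij hjl)
  refine quasiIso_of_elements _ ?_ ?_
  · intro i j l hij hjl x y hx hy
    have h := exists_baseChange_eq hε hn (toLinearMap_smul (P.d i j)) (toLinearMap_smul (P.d j l))
      (hd i j l) (hM j) (fun m z hz => exists_mem_pow_map_eq hε (toLinearMap_smul (P.d i j))
        (hd (i - 1) i j) (hM j) (hT' (i - 1) i j (by lia) hij) (hd i j l) (hE i j l hij hjl) m z hz)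
      (hE i j l hij hjl) x hx ⟨y, hy⟩
    obtain ⟨z, hz⟩ := h
    exact ⟨z, hz⟩
  · intro i j l hij hjl y hy
    have h := mem_range_sup_invariantCycles hε (toLinearMap_smul (P.d j l)) (hd i j l) hn (hM l)
      (hT' i j l hij hjl) (hd j l (l + 1)) (hE j l (l + 1) hjl rfl) y hy
    obtain ⟨_, ⟨z, rfl⟩, q, hq, rfl⟩ := Submodule.mem_sup.1 h
    obtain ⟨x, hx, rfl⟩ := invariantCycles_le_map k H _ (toLinearMap_smul (P.d j l)) hq
    exact ⟨x, z, hx, add_comm _ _⟩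

include hinv hn in
/-- A complex of equivariant modules whose derived fibre has trivial action is the pullback of the
invariants of a resolution with projective terms. -/
lemma essImage_pullback_of_leftDerived_fiber {F : DerivedCategory (EquivariantModule C H)}
    (hF : IsTrivialAction ((leftDerived (fiber ε hε)).obj F)) :
    (pullback k C H).mapDerivedCategory.essImage F := by
  obtain ⟨P, p, hP, hPX, hp⟩ :=
    exists_kProjective_resolution_projective (DerivedCategory.Q.objPreimage F)
  let eF : DerivedCategory.Q.obj P ≅ F :=
    asIso (DerivedCategory.Q.map p) ≪≫ DerivedCategory.Q.objObjPreimageIso F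
  obtain ⟨W, ⟨e⟩⟩ := hF
  have := quasiIso_counit (hε := hε) hinv hn P hPX
    (hasTrivialAction_homology_of_isTrivialAction _ ⟨W, ⟨e ≪≫
      (leftDerived (fiber ε hε)).mapIso eF.symm ≪≫ leftDerivedObjIso (fiber ε hε) P⟩⟩)
  exact ⟨_, ⟨(pullback k C H).mapDerivedCategoryFactors.app
    (((invariantsFunctor k C H).mapHomologicalComplex (ComplexShape.up ℤ)).obj P) ≪≫
    asIso (DerivedCategory.Q.map (counitComplex k P)) ≪≫ eF⟩⟩

end Descent

end

end CoinvariantDescent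

theorem mainTheorem6 {k V H : Type u} [Field k] [CharZero k] [AddCommGroup V] [Module k V]
    [Group H] [Finite H] (ρ : Representation k H V) :
    Function.Bijective (algebraMap k
      (FixedPoints.subalgebra k (CoinvariantDescent.CoinvariantAlgebra ρ) H)) ∧
    (∀ m : Ideal (CoinvariantDescent.CoinvariantAlgebra ρ),
      m.IsMaximal ↔ m = RingHom.ker (CoinvariantDescent.CoinvariantAlgebra.ε ρ)) ∧
    ∀ F : CoinvariantDescent.EquivariantSheaf ρ,
      CoinvariantDescent.Descends ρ F ↔
        CoinvariantDescent.IsTrivialAction ((CoinvariantDescent.derivedFiber ρ).obj F) := by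
  have := Fintype.ofFinite H
  obtain ⟨n, hn⟩ := CoinvariantDescent.CoinvariantAlgebra.ker_ε_pow ρ
  refine ⟨CoinvariantDescent.CoinvariantAlgebra.bijective_algebraMap_fixedPoints ρ,
    CoinvariantDescent.CoinvariantAlgebra.isMaximal_iff ρ, fun F =>
    ⟨CoinvariantDescent.essImage_trivialFunctor_leftDerived_fiber _ _,
      CoinvariantDescent.essImage_pullback_of_leftDerived_fiber (fun c hc hcH => ?_) hn⟩⟩
  rw [CoinvariantDescent.CoinvariantAlgebra.eq_algebraMap_of_invariant ρ c hcH, hc, map_zero]
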